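/- Let $n,m\ge 1$ be integers, $p>1$ real, and let $u_0\in L^1(\mathbb{R}^n)\cap L^\infty(\mathbb{R}^n)$ be real-valued with $\int_{\mathbb{R}^n}u_0\,dx>0$. For $\varepsilon>0$ consider $$u_t+(-\Delta)^m u=|u|^p\quad (x\in\mathbb{R}^n,\ t>0),\qquad u(\cdot,0)=\varepsilon u_0 .$$ For $T>0$, a mild solution on $[0,T)$ is a function $u\in C([0,T);L^1(\mathbb{R}^n))\cap L^\infty((0,T);L^\infty(\mathbb{R}^n))$ such that, for every $t\in[0,T)$ and almost every $x$, $$u(t)=\varepsilon e^{-t(-\Delta)^m}u_0+\int_0^t e^{-(t-s)(-\Delta)^m}|u(s)|^p\,ds ,$$ where $e^{-t(-\Delta)^m}$ is the Fourier multiplier semigroup with symbol $e^{-t|\xi|^{2m}}$, i.e. convolution with its kernel for $t>0$ and the identity for $t=0$. The lifespan is $$T_\varepsilon:=\sup\{T>0 : \text{there is a unique mild solution on }[0,T)\}\in[0,\infty].$$ Then: (i) For every $\varepsilon>0$ there is $T>0$ for which there is a unique mild solution on $[0,T)$; in particular $T_\varepsilon>0$. Moreover there is a function $u$ on $[0,T_\varepsilon)$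 that is a mild solution on $[0,T)$ for every finite $0<T<T_\varepsilon$, and every mild solution on any $[0,T)$ coincides with $u$ on $[0,T)$. (ii) If $1<p<1+\frac{2m}{n}$, there are constants $\varepsilon_0,c,C>0$, depending only on $n,m,p,u_0$, such that for all $0<\varepsilon<\varepsilon_0$ $$c\,\varepsilon^{-\left(\frac1{p-1}-\frac n{2m}\right)^{-1}}\le T_\varepsilon\le C\,\varepsilon^{-\left(\frac1{p-1}-\frac n{2m}\right)^{-1}} .$$ (iii) If $p=1+\frac{2m}{n}$, there are constants $\varepsilon_0,c,C>0$, depending only on $n,m,p,u_0$, such that for all $0<\varepsilon<\varepsilon_0$ $$\exp\!\left(c\,\varepsilon^{-(p-1)}\right)\le T_\varepsilon\le \exp\!\left(C\,\varepsilon^{-(p-1)}\right).$$ -/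

import Mathlib

open MeasureTheory Set
open scoped ENNReal FourierTransform

/-- The kernel of `exp (-t (-Δ)^m)` on `ℝⁿ` for `t > 0`: the inverse Fourier transform of the
symbol `exp (-t (2π|ξ|)^(2m))` (with Mathlib's convention `e^{2πi⟪x, ξ⟫}` the symbol of `-Δ`
is `(2π|ξ|)^2`). The symbol is even, so the kernel is real. -/
noncomputable def polyKernel (n m : ℕ) (t : ℝ) (x : EuclideanSpace ℝ (Fin n)) : ℝ :=
  (𝓕⁻ (fun ξ : EuclideanSpace ℝ (Fin n) =>
    ((Real.exp (-t * (2 * Real.pi * ‖ξ‖) ^ (2 * m)) : ℝ) : ℂ)) x).re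

/-- The semigroup `exp (-t (-Δ)^m)`, `t ≥ 0`, acting on functions: the identity at `t = 0`,
convolution with the kernel for `t > 0`. -/
noncomputable def polySemigroup (n m : ℕ) (t : ℝ) (f : EuclideanSpace ℝ (Fin n) → ℝ)
    (x : EuclideanSpace ℝ (Fin n)) : ℝ :=
  if t = 0 then f x else ∫ y, polyKernel n m t (x - y) * f y

/-- `u` belongs to `C([0,T); L¹(ℝⁿ)) ∩ L^∞((0,T); L^∞(ℝⁿ))`; the second space is the Bochner
space, so that `u` has to agree, for almost every time, with an essentially bounded, strongly
measurable `L^∞`-valued function. -/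
def InSolutionClass (n : ℕ) (T : ℝ)
    (u : ℝ → Lp ℝ 1 (volume : Measure (EuclideanSpace ℝ (Fin n)))) : Prop :=
  ContinuousOn u (Ico 0 T) ∧
  ∃ w : ℝ → Lp ℝ ∞ (volume : Measure (EuclideanSpace ℝ (Fin n))),
    MemLp w ∞ (volume.restrict (Ioo 0 T)) ∧
    ∀ᵐ t ∂(volume.restrict (Ioo 0 T)), w t =ᵐ[volume] u t

/-- `u` is a mild solution on `[0,T)` of `u_t + (-Δ)^m u = |u|^p`, `u(0) = ε u₀`, in the class
`C([0,T); L¹) ∩ L^∞((0,T); L^∞)`. For `u` in this class the integrand of the Duhamel term is,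
at each `x`, a bounded continuous function of `s ∈ [0,t)`. -/
def IsMildSolution (n m : ℕ) (p : ℝ) (u₀ : EuclideanSpace ℝ (Fin n) → ℝ) (ε T : ℝ)
    (u : ℝ → Lp ℝ 1 (volume : Measure (EuclideanSpace ℝ (Fin n)))) : Prop :=
  InSolutionClass n T u ∧
  ∀ t ∈ Ico 0 T, ∀ᵐ x ∂(volume : Measure (EuclideanSpace ℝ (Fin n))),
    u t x = ε * polySemigroup n m t u₀ x +
      ∫ s in (0 : ℝ)..t, polySemigroup n m (t - s) (fun y => |u s y| ^ p) x

/-- There is one and only one mild solution on `[0,T)`. -/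
def HasUniqueMildSolution (n m : ℕ) (p : ℝ) (u₀ : EuclideanSpace ℝ (Fin n) → ℝ)
    (ε T : ℝ) : Prop :=
  ∃ u, IsMildSolution n m p u₀ ε T u ∧
    ∀ v, IsMildSolution n m p u₀ ε T v → EqOn v u (Ico 0 T)

/-- The lifespan: the supremum (possibly infinite) of all `T > 0` such that there is a unique mild
solution on `[0,T)`. -/
noncomputable def lifespan (n m : ℕ) (p : ℝ) (u₀ : EuclideanSpace ℝ (Fin n) → ℝ)
    (ε : ℝ) : ℝ≥0∞ :=
  sSup {τ | ∃ T : ℝ, 0 < T ∧ HasUniqueMildSolution n m p u₀ ε T ∧ τ = ENNReal.ofReal T}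

/-! Put θ = n(p-1)/(2m). Both lifespan bounds come from one time integral. A solution exists up to
`T` as soon as ε^{p-1} ∫₀ᵀ (1+s)^{-θ} ds is small (`exists_isMildSolution`), and a solution on [0,T)
forces ∫_{t₀}^{t₁} s^{-θ} ds ≤ κ ε^{-(p-1)} for all t₁ in [t₀,T)
(`exists_integral_bound_of_isMildSolution`). For θ < 1 the integrals grow like T^{1-θ}, for θ = 1
like log T, which gives the power and the exponential law.

Everything rests on the kernel `K` at time 1 being a Schwartz function of integral 1. By scaling,
the semigroup at time t averages the translates by t^{1/(2m)} z with weight K(z)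
(`polySemigroup_eq`). For m ≥ 2 the kernel changes sign, so no comparison principle is used.

Existence is a contraction in the ball where the L¹ norm is at most M and |u(t)| ≤ M(1+t)^{-n/(2m)},
with M proportional to ε (`exists_fixedPoint`). The decay comes from interpolating between L^∞
stability and L¹–L^∞ smoothing (`exists_polyOp_decay`). The power is truncated at the known bound,
so that it is Lipschitz on L¹. Uniqueness is Grönwall's inequality in L¹ (`IsMildSolution.eqOn`).
Membership in the Bochner class needs strong measurability in L^∞, which follows from continuity in
the supremum norm at positive times (`exists_modulus`).

For the upper bound, test with the positive, slowly varying weight φ_R(x) = (1+|x|/R)^{-n-1} at R =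
L t^{1/(2m)}. If L is large, the semigroup up to time t changes ∫ φ_R f by at most a small multiple
of ∫ φ_R |f| (`weightedIntegral_polyOp_ge`). This replaces positivity of the kernel, because the
forcing |u|^p is nonnegative. With Jensen's inequality, A(t) = ∫ φ_R |u(t)| satisfies A(t) ≥ aε + c
∫_{t₀}^t s^{-θ} A(s)^p ds with a > 0 (`exists_superlinear_inequality`), and such a function cannot
last long (`integral_le_of_superlinear`). -/

/-- The exponential of minus a function of temperate growth that dominates the norm outside the
unit ball is a Schwartz function. -/
theorem exists_schwartzMap_exp_neg {V : Type*} [NormedAddCommGroup V] [NormedSpace ℝ V]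
    {Q : V → ℝ} (hQ : Q.HasTemperateGrowth) (hlow : ∀ x, ‖x‖ ≤ 1 + Q x) :
    ∃ f : SchwartzMap V ℂ, ∀ x, f x = ((Real.exp (-Q x) : ℝ) : ℂ) := by
  have hneg := hQ.neg
  have hsm : ContDiff ℝ (⊤ : ℕ∞) (fun x => Real.exp (-Q x)) := Real.contDiff_exp.comp hneg.1
  have hdec : ∀ k l : ℕ, ∃ C : ℝ, ∀ x,
      ‖x‖ ^ k * ‖iteratedFDeriv ℝ l (fun x => Real.exp (-Q x)) x‖ ≤ C := by
    intro k l
    obtain ⟨j, C, hC, hb⟩ := hneg.norm_iteratedFDeriv_le_uniform l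
    -- The derivatives of the exponential contribute l! e^{-Q} times the l-th power of a polynomial
    -- bound. The polynomial factors are absorbed by N! e^{1+‖x‖} ≤ N! e^{2+Q} with N = k + j l,
    -- whence e².
    refine ⟨(l.factorial : ℝ) * (1 + C) ^ l * ((k + j * l).factorial * Real.exp 2), fun x => ?_⟩
    have hx : (1 : ℝ) ≤ 1 + ‖x‖ := by linarith [norm_nonneg x]
    have hD1 : 1 ≤ (1 + C) * (1 + ‖x‖) ^ j := by
      have : (1 : ℝ) ≤ (1 + ‖x‖) ^ j := one_le_pow₀ hx
      nlinarith
    have key := norm_iteratedFDeriv_comp_le (𝕜 := ℝ) (g := Real.exp) (f := -Q) (n := l)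
      (N := (l : ℕ)) (Real.contDiff_exp) (hneg.1.of_le (mod_cast le_top)) le_rfl x
      (C := Real.exp (-Q x)) (D := (1 + C) * (1 + ‖x‖) ^ j)
      (fun i _ => by
        rw [norm_iteratedFDeriv_eq_norm_iteratedDeriv, iteratedDeriv_eq_iterate,
          Real.iter_deriv_exp]
        simp)
      (fun i hi hil => by
        refine (hb i hil x).trans (le_trans ?_ (le_self_pow₀ hD1 (by omega)))
        gcongr
        linarith)
    have hcomp : (Real.exp ∘ (-Q)) = fun x => Real.exp (-Q x) := rfl
    rw [hcomp] at key
    have h2 : (1 + ‖x‖) ^ (k + j * l) * Real.exp (-Q x) ≤ (k + j * l).factorial * Real.exp 2 := by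
      have h3 : (1 + ‖x‖) ^ (k + j * l) ≤ (k + j * l).factorial * Real.exp (1 + ‖x‖) := by
        have := Real.pow_div_factorial_le_exp (1 + ‖x‖) (by linarith) (k + j * l)
        rwa [div_le_iff₀ (by positivity), mul_comm (Real.exp _)] at this
      calc _ ≤ (k + j * l).factorial * Real.exp (1 + ‖x‖) * Real.exp (-Q x) := by gcongr
        _ = (k + j * l).factorial * Real.exp (1 + ‖x‖ + -Q x) := by
          rw [Real.exp_add _ (-Q x), mul_assoc]
        _ ≤ _ := by
          gcongr
          linarith [hlow x]
    calc _ ≤ (1 + ‖x‖) ^ k * (l.factorial * Real.exp (-Q x) * ((1 + C) * (1 + ‖x‖) ^ j) ^ l) := by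
          gcongr
          linarith
      _ = (l.factorial : ℝ) * (1 + C) ^ l * ((1 + ‖x‖) ^ (k + j * l) * Real.exp (-Q x)) := by
          rw [mul_pow, ← pow_mul, pow_add]; ring
      _ ≤ _ := by gcongr
  refine ⟨⟨fun x => ((Real.exp (-Q x) : ℝ) : ℂ), Complex.ofRealCLM.contDiff.comp hsm, ?_⟩,
    fun x => rfl⟩
  intro k l
  obtain ⟨C, hC⟩ := hdec k l
  refine ⟨C, fun x => le_trans ?_ (hC x)⟩
  gcongr
  have := Complex.ofRealCLM.norm_iteratedFDeriv_comp_left (f := fun x => Real.exp (-Q x)) (x := x)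
    (hsm.contDiffAt) (n := l) (mod_cast le_top)
  refine le_trans this ?_
  rw [Complex.ofRealCLM_norm, one_mul]

/-! ### The kernel at time 1 and its scaling. -/

section Kernel

variable (n m : ℕ)

theorem exists_schwartzMap_symbol (hm : 1 ≤ m) :
    ∃ f : SchwartzMap (EuclideanSpace ℝ (Fin n)) ℂ, ∀ ξ,
      f ξ = ((Real.exp (-1 * (2 * Real.pi * ‖ξ‖) ^ (2 * m)) : ℝ) : ℂ) := by
  -- The symbol is written through ‖ξ‖², which is smooth at the origin, unlike ‖ξ‖.
  have hQ : (fun ξ : EuclideanSpace ℝ (Fin n) =>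
      ((2 * Real.pi) ^ 2 * ‖ξ‖ ^ 2) ^ m).HasTemperateGrowth := by fun_prop
  obtain ⟨f, hf⟩ := exists_schwartzMap_exp_neg hQ (fun x => by
    have hpi := Real.pi_gt_three
    by_cases h : ‖x‖ ≤ 1
    · have : 0 ≤ ((2 * Real.pi) ^ 2 * ‖x‖ ^ 2) ^ m := by positivity
      linarith
    · push Not at h
      have h1 : ‖x‖ ≤ (2 * Real.pi) ^ 2 * ‖x‖ ^ 2 := by
        have h3 : 1 ≤ (2 * Real.pi) ^ 2 := by nlinarith
        nlinarith [sq_nonneg ‖x‖]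
      have h2 := le_self_pow₀ (h.le.trans h1) (show m ≠ 0 by omega)
      linarith)
  refine ⟨f, fun ξ => ?_⟩
  rw [hf, pow_mul, mul_pow (2 * Real.pi) ‖ξ‖, neg_one_mul]

/-- The integral of the kernel is its Fourier transform at 0, hence the symbol at 0, which equals 1
because m ≥ 1. -/
theorem exists_schwartzMap_kernel (hm : 1 ≤ m) :
    ∃ g : SchwartzMap (EuclideanSpace ℝ (Fin n)) ℂ,
      (∀ x, polyKernel n m 1 x = (g x).re) ∧ ∫ x, (g x).re = 1 := by
  obtain ⟨f, hf⟩ := exists_schwartzMap_symbol n m hm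
  refine ⟨𝓕⁻ f, fun x => ?_, ?_⟩
  · rw [SchwartzMap.fourierInv_coe, polyKernel, show (⇑f) = _ from funext hf]
  · have h0 : 𝓕 (𝓕⁻ f) 0 = f 0 := by simp
    rw [SchwartzMap.fourier_coe, Real.fourier_eq] at h0
    simp only [inner_zero_right, neg_zero, AddChar.map_zero_eq_one, one_smul, hf, norm_zero,
      mul_zero] at h0
    rw [zero_pow (by omega)] at h0
    have := congrArg Complex.re h0
    have h3 := integral_re (𝕜 := ℂ) (SchwartzMap.integrable (𝓕⁻ f) (μ := volume))
    simp only [RCLike.re_to_complex] at h3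
    rw [h3, this]
    simp

theorem polyKernel_continuous (hm : 1 ≤ m) : Continuous (polyKernel n m 1) := by
  obtain ⟨g, hg, -⟩ := exists_schwartzMap_kernel n m hm
  rw [funext hg]
  exact Complex.continuous_re.comp g.continuous

theorem polyKernel_integral (hm : 1 ≤ m) : ∫ x, polyKernel n m 1 x = 1 := by
  obtain ⟨g, hg, h⟩ := exists_schwartzMap_kernel n m hm
  rw [funext hg, h]

theorem polyKernel_integrable_pow (hm : 1 ≤ m) (k : ℕ) :
    Integrable (fun x => ‖x‖ ^ k * |polyKernel n m 1 x|) := by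
  obtain ⟨g, hg, -⟩ := exists_schwartzMap_kernel n m hm
  refine (g.integrable_pow_mul volume k).mono' ?_ (ae_of_all _ fun x => ?_)
  · have := polyKernel_continuous n m hm
    exact (by fun_prop : Continuous _).aestronglyMeasurable
  · rw [hg, norm_mul, norm_pow, norm_norm, Real.norm_eq_abs, abs_abs]
    gcongr
    exact Complex.abs_re_le_norm _

theorem polyKernel_integrable (hm : 1 ≤ m) : Integrable (polyKernel n m 1) := by
  have h := polyKernel_integrable_pow n m hm 0
  simp only [pow_zero, one_mul] at h
  exact (integrable_norm_iff (polyKernel_continuous n m hm).aestronglyMeasurable).1 h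

theorem polyKernel_decay (hm : 1 ≤ m) (k : ℕ) :
    ∃ C : ℝ, 0 < C ∧ ∀ x, (1 + ‖x‖) ^ k * |polyKernel n m 1 x| ≤ C := by
  obtain ⟨g, hg, -⟩ := exists_schwartzMap_kernel n m hm
  refine ⟨2 ^ k * (Finset.Iic (k, 0)).sup (fun j => SchwartzMap.seminorm ℝ j.1 j.2) g + 1,
    by positivity, fun x => ?_⟩
  have h := SchwartzMap.one_add_le_sup_seminorm_apply (𝕜 := ℝ) (m := (k, 0)) le_rfl le_rfl g x
  rw [norm_iteratedFDeriv_zero] at h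
  have h2 : |polyKernel n m 1 x| ≤ ‖g x‖ := by rw [hg]; exact Complex.abs_re_le_norm _
  have h3 := mul_le_mul_of_nonneg_left h2 (show 0 ≤ (1 + ‖x‖) ^ k by positivity)
  dsimp only at h
  linarith

/-- Substitute rξ for ξ in the inverse Fourier integral. -/
theorem polyKernel_scale {r : ℝ} (hr : 0 < r) (x : EuclideanSpace ℝ (Fin n)) :
    polyKernel n m (r ^ (2 * m)) x = (r ^ n)⁻¹ * polyKernel n m 1 (r⁻¹ • x) := by
  have h := Measure.integral_comp_smul (volume : Measure (EuclideanSpace ℝ (Fin n)))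
    (fun ξ => 𝐞 (inner ℝ ξ (r⁻¹ • x)) •
      ((Real.exp (-1 * (2 * Real.pi * ‖ξ‖) ^ (2 * m)) : ℝ) : ℂ)) r
  rw [finrank_euclideanSpace_fin, abs_of_pos (by positivity)] at h
  rw [polyKernel, polyKernel, Real.fourierInv_eq, Real.fourierInv_eq, ← Complex.re_ofReal_mul,
    ← Complex.real_smul, ← h]
  congr 2
  ext ξ
  rw [inner_smul_left, inner_smul_right]
  simp only [norm_smul, Real.norm_eq_abs, abs_of_pos hr, conj_trivial]
  rw [← mul_assoc r, mul_inv_cancel₀ hr.ne', one_mul]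
  rw [neg_one_mul, mul_left_comm (2 * Real.pi), mul_pow r, neg_mul]

/-- The semigroup averages dilated translates against the kernel at time `1`. -/
theorem polySemigroup_eq (hm : 1 ≤ m) {t : ℝ} (ht : 0 ≤ t) (f : EuclideanSpace ℝ (Fin n) → ℝ)
    (x : EuclideanSpace ℝ (Fin n)) :
    polySemigroup n m t f x =
      ∫ z, polyKernel n m 1 z * f (x - t ^ (1 / (2 * m : ℝ)) • z) := by
  have hm' : (0 : ℝ) < 2 * m := by positivity
  rcases ht.eq_or_lt with rfl | ht
  · rw [Real.zero_rpow (by positivity)]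
    simp [polySemigroup, integral_mul_const, polyKernel_integral n m hm]
  · obtain ⟨r, hr, hrt⟩ : ∃ r : ℝ, 0 < r ∧ t ^ (1 / (2 * m : ℝ)) = r :=
      ⟨_, Real.rpow_pos_of_pos ht _, rfl⟩
    have hrt' : t = r ^ (2 * m) := by
      rw [← hrt, ← Real.rpow_natCast, ← Real.rpow_mul ht.le]
      push_cast
      rw [one_div, inv_mul_cancel₀ hm'.ne', Real.rpow_one]
    rw [polySemigroup, if_neg ht.ne', hrt, hrt']
    simp_rw [polyKernel_scale n m hr]
    have h1 := integral_sub_left_eq_self (fun y => (r ^ n)⁻¹ * polyKernel n m 1 (r⁻¹ • y) *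
      f (x - y)) (volume : Measure (EuclideanSpace ℝ (Fin n))) x
    simp only [sub_sub_cancel] at h1
    rw [h1]
    have h2 := Measure.integral_comp_smul (volume : Measure (EuclideanSpace ℝ (Fin n)))
      (fun y => (r ^ n)⁻¹ * polyKernel n m 1 (r⁻¹ • y) * f (x - y)) r
    rw [finrank_euclideanSpace_fin, abs_of_pos (by positivity), smul_eq_mul,
      ← inv_mul_eq_iff_eq_mul₀ (by positivity), inv_inv] at h2
    rw [← h2, ← integral_const_mul]
    congr 1
    ext z
    rw [smul_smul, inv_mul_cancel₀ hr.ne', one_smul]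
    have : r ^ n ≠ 0 := by positivity
    field_simp

end Kernel

/-! ### Weighted integrals, and essential bounds of Bochner integrals in L¹. -/

section Pairing

variable {X : Type*} [MeasurableSpace X] {μ : Measure X}

/-- Integration of integrable functions against a fixed essentially bounded weight. -/
noncomputable def weightedIntegral (φ : X → ℝ) (hφ : MemLp φ ∞ μ) : Lp ℝ 1 μ →L[ℝ] ℝ :=
  (ContinuousLinearMap.mul ℝ ℝ).lpPairing μ ∞ 1 (hφ.toLp φ)

theorem weightedIntegral_apply {φ : X → ℝ} (hφ : MemLp φ ∞ μ) (f : Lp ℝ 1 μ) :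
    weightedIntegral φ hφ f = ∫ x, φ x * f x ∂μ := by
  rw [weightedIntegral, ContinuousLinearMap.lpPairing_eq_integral]
  refine integral_congr_ae ?_
  filter_upwards [hφ.coeFn_toLp] with x hx
  simp [hx]

theorem memLp_top_indicator_one {s : Set X} (hs : MeasurableSet s) :
    MemLp (s.indicator fun _ => (1 : ℝ)) ∞ μ :=
  (memLp_top_const (1 : ℝ)).indicator hs

theorem weightedIntegral_indicator {s : Set X} (hs : MeasurableSet s) (f : Lp ℝ 1 μ) :
    weightedIntegral _ (memLp_top_indicator_one hs) f = ∫ x in s, f x ∂μ := by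
  rw [weightedIntegral_apply, ← integral_indicator hs]
  congr 1
  ext x
  by_cases hx : x ∈ s <;> simp [hx]

/-- Point evaluations make no sense on L¹, but integration over `s` is a continuous functional and
commutes with the Bochner integral. Pointwise information is recovered from these functionals. -/
theorem setIntegral_coe_integral {α : Type*} [MeasurableSpace α] {ν : Measure α}
    {G : α → Lp ℝ 1 μ} (hG : Integrable G ν) {s : Set X} (hs : MeasurableSet s) :
    ∫ x in s, (∫ a, G a ∂ν : Lp ℝ 1 μ) x ∂μ = ∫ a, ∫ x in s, G a x ∂μ ∂ν := by
  rw [← weightedIntegral_indicator hs, ← ContinuousLinearMap.integral_comp_comm _ hG]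
  simp_rw [weightedIntegral_indicator hs]

/-- A Bochner integral in `L¹` is computed pointwise for a jointly measurable representative. -/
theorem coe_integral_ae_eq {α : Type*} [MeasurableSpace α] {ν : Measure α} [SFinite ν]
    [SFinite μ] {G : α → Lp ℝ 1 μ} (hG : Integrable G ν) {F : α → X → ℝ}
    (hF : AEStronglyMeasurable (Function.uncurry F) (ν.prod μ))
    (h : ∀ᵐ a ∂ν, G a =ᵐ[μ] F a) :
    (∫ a, G a ∂ν : Lp ℝ 1 μ) =ᵐ[μ] fun x => ∫ a, F a x ∂ν := by
  have hFi : Integrable (Function.uncurry F) (ν.prod μ) := by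
    rw [integrable_prod_iff hF]
    refine ⟨?_, ?_⟩
    · filter_upwards [h] with a ha
      exact (L1.integrable_coeFn (G a)).congr ha
    · refine hG.norm.congr ?_
      filter_upwards [h] with a ha
      rw [L1.norm_eq_integral_norm]
      refine integral_congr_ae ?_
      filter_upwards [ha] with x hx
      simp [hx]
  refine Integrable.ae_eq_of_forall_setIntegral_eq _ _ (L1.integrable_coeFn _)
    hFi.integral_prod_right fun s hs _ => ?_
  rw [setIntegral_coe_integral hG hs]
  have hs' : Integrable (Function.uncurry F) (ν.prod (μ.restrict s)) := by
    have := hFi.integrableOn (s := univ ×ˢ s)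
    rwa [IntegrableOn, ← Measure.prod_restrict, Measure.restrict_univ] at this
  rw [← integral_integral_swap hs']
  refine integral_congr_ae ?_
  filter_upwards [h] with a ha
  exact integral_congr_ae (ae_restrict_of_ae ha)

/-- Expresses an essential bound through continuous linear functionals, so that it survives L¹
limits and Bochner integration. -/
theorem ae_le_const_iff_forall_setIntegral_le [SigmaFinite μ] (f : Lp ℝ 1 μ) (c : ℝ) :
    (∀ᵐ x ∂μ, f x ≤ c) ↔
      ∀ s, MeasurableSet s → μ s < ∞ → ∫ x in s, f x ∂μ ≤ c * μ.real s := by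
  have hf := L1.integrable_coeFn f
  constructor
  · intro h s hs hμ
    have := setIntegral_mono_ae hf.integrableOn (integrableOn_const hμ.ne) h (s := s) (μ := μ)
    rwa [setIntegral_const, smul_eq_mul, mul_comm] at this
  · intro h
    have hc : ∀ s, μ s < ∞ → IntegrableOn (fun _ => c) s μ := fun s hμ => integrableOn_const hμ.ne
    have := ae_nonneg_of_forall_setIntegral_nonneg_of_sigmaFinite (μ := μ) (f := fun x => c - f x)
      (fun s _ hμ => (hc s hμ).sub hf.integrableOn) (fun s hs hμ => by
        rw [integral_sub (hc s hμ) hf.integrableOn, setIntegral_const,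
          smul_eq_mul, mul_comm]
        linarith [h s hs hμ])
    filter_upwards [this] with x hx
    exact sub_nonneg.1 hx

theorem isClosed_ae_abs_le [SigmaFinite μ] (c : ℝ) :
    IsClosed {f : Lp ℝ 1 μ | ∀ᵐ x ∂μ, |f x| ≤ c} := by
  have hle : IsClosed {f : Lp ℝ 1 μ | ∀ᵐ x ∂μ, f x ≤ c} := by
    simp_rw [ae_le_const_iff_forall_setIntegral_le, ofPred_forall]
    refine isClosed_iInter fun s => isClosed_iInter fun _ => isClosed_iInter fun _ => ?_
    exact isClosed_le (continuous_setIntegral s) continuous_const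
  have : {f : Lp ℝ 1 μ | ∀ᵐ x ∂μ, |f x| ≤ c} =
      {f : Lp ℝ 1 μ | ∀ᵐ x ∂μ, f x ≤ c} ∩ (fun f => -f) ⁻¹' {f : Lp ℝ 1 μ | ∀ᵐ x ∂μ, f x ≤ c} := by
    ext f
    simp only [mem_ofPred_eq, mem_inter_iff, mem_preimage, ← Filter.eventually_and]
    refine Filter.eventually_congr ?_
    filter_upwards [Lp.coeFn_neg f] with x hx
    rw [hx, Pi.neg_apply, abs_le']
  rw [this]
  exact hle.inter (hle.preimage continuous_neg)

theorem ae_coe_integral_le {α : Type*} [MeasurableSpace α] {ν : Measure α} [SigmaFinite μ]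
    {G : α → Lp ℝ 1 μ} (hG : Integrable G ν) {b : α → ℝ} (hb : Integrable b ν)
    (h : ∀ᵐ a ∂ν, ∀ᵐ x ∂μ, G a x ≤ b a) :
    ∀ᵐ x ∂μ, (∫ a, G a ∂ν : Lp ℝ 1 μ) x ≤ ∫ a, b a ∂ν := by
  rw [ae_le_const_iff_forall_setIntegral_le]
  intro s hs hμ
  rw [setIntegral_coe_integral hG hs, ← integral_mul_const]
  refine integral_mono_ae ?_ (hb.mul_const _) ?_
  · have := (weightedIntegral _ (memLp_top_indicator_one (μ := μ) hs)).integrable_comp hG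
    simpa only [weightedIntegral_indicator hs] using this
  · filter_upwards [h] with a ha
    exact (ae_le_const_iff_forall_setIntegral_le (G a) (b a)).1 ha s hs hμ

/-- Essential bounds are preserved by Bochner integration in `L¹`. -/
theorem ae_abs_coe_integral_le {α : Type*} [MeasurableSpace α] {ν : Measure α} [SigmaFinite μ]
    {G : α → Lp ℝ 1 μ} (hG : Integrable G ν) {b : α → ℝ} (hb : Integrable b ν)
    (h : ∀ᵐ a ∂ν, ∀ᵐ x ∂μ, |G a x| ≤ b a) :
    ∀ᵐ x ∂μ, |(∫ a, G a ∂ν : Lp ℝ 1 μ) x| ≤ ∫ a, b a ∂ν := by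
  have h1 := ae_coe_integral_le hG hb (h.mono fun a ha => ha.mono fun x hx => (abs_le.1 hx).2)
  have h2 := ae_coe_integral_le hG.neg hb (h.mono fun a ha => by
    filter_upwards [ha, Lp.coeFn_neg (G a)] with x hx hn
    rw [Pi.neg_apply, hn, Pi.neg_apply]
    linarith [(abs_le.1 hx).1])
  simp only [Pi.neg_apply, integral_neg] at h2
  filter_upwards [h1, h2, Lp.coeFn_neg (∫ a, G a ∂ν)] with x hx1 hx2 hn
  rw [hn, Pi.neg_apply] at hx2
  exact abs_le.2 ⟨by linarith, hx1⟩

end Pairing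

/-- The space `L¹(ℝⁿ)`. -/
abbrev IntegrableSpace (n : ℕ) : Type :=
  Lp ℝ 1 (volume : Measure (EuclideanSpace ℝ (Fin n)))

/-! ### Convolution on L¹ as an average of translates. -/

section Convolution

variable {n : ℕ}

/-- Translation by `y`, as a linear isometry of `L¹`. -/
noncomputable def translateL1 (y : EuclideanSpace ℝ (Fin n)) :
    IntegrableSpace n →ₗᵢ[ℝ] IntegrableSpace n :=
  Lp.compMeasurePreservingₗᵢ ℝ (fun x => x - y) (measurePreserving_sub_right volume y)

theorem translateL1_coeFn (y : EuclideanSpace ℝ (Fin n)) (f : IntegrableSpace n) :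
    translateL1 y f =ᵐ[volume] fun x => f (x - y) :=
  Lp.coeFn_compMeasurePreserving f (measurePreserving_sub_right volume y)

theorem continuous_translateL1 : Continuous fun q : EuclideanSpace ℝ (Fin n) × IntegrableSpace n =>
    translateL1 q.1 q.2 := by
  let g : EuclideanSpace ℝ (Fin n) × IntegrableSpace n →
      C(EuclideanSpace ℝ (Fin n), EuclideanSpace ℝ (Fin n)) :=
    fun q => ⟨fun x => x - q.1, by fun_prop⟩
  have hg : Continuous g := ContinuousMap.continuous_of_continuous_uncurry _ (by
    change Continuous fun w : (EuclideanSpace ℝ (Fin n) × IntegrableSpace n) ×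
      EuclideanSpace ℝ (Fin n) => w.2 - w.1.1
    fun_prop)
  exact Continuous.compMeasurePreservingLp continuous_snd hg
    (fun q => measurePreserving_sub_right volume q.1) ENNReal.one_ne_top

theorem translateL1_ae_abs_le {f : IntegrableSpace n} {b : ℝ}
    (hf : ∀ᵐ x ∂(volume : Measure (EuclideanSpace ℝ (Fin n))), |f x| ≤ b)
    (y : EuclideanSpace ℝ (Fin n)) :
    ∀ᵐ x ∂(volume : Measure (EuclideanSpace ℝ (Fin n))), |translateL1 y f x| ≤ b := by
  have := (measurePreserving_sub_right volume y).quasiMeasurePreserving.ae hf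
  filter_upwards [translateL1_coeFn y f, this] with x hx h
  rwa [hx]

variable {K : EuclideanSpace ℝ (Fin n) → ℝ}

theorem integrable_smul_translateL1 (hK : Integrable K) (r : ℝ) (f : IntegrableSpace n) :
    Integrable fun z => K z • translateL1 (r • z) f := by
  have hc : Continuous fun z : EuclideanSpace ℝ (Fin n) => translateL1 (r • z) f :=
    continuous_translateL1.comp (f := fun z => (r • z, f)) (by fun_prop)
  refine (hK.norm.mul_const ‖f‖).mono' (hK.1.smul hc.aestronglyMeasurable) (ae_of_all _ fun z => ?_)
  rw [norm_smul, LinearIsometry.norm_map]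

/-- Averages of the translates of an integrable function by the vectors `r z`, with weight `K z`;
for `r > 0` this is the convolution with a rescaled kernel. -/
noncomputable def dilatedConv (K : EuclideanSpace ℝ (Fin n) → ℝ) (hK : Integrable K) (r : ℝ) :
    IntegrableSpace n →L[ℝ] IntegrableSpace n :=
  LinearMap.mkContinuous
    { toFun := fun f => ∫ z, K z • translateL1 (r • z) f
      map_add' := fun f g => by
        simp only [map_add, smul_add]
        exact integral_add (integrable_smul_translateL1 hK r f) (integrable_smul_translateL1 hK r g)
      map_smul' := fun c f => by
        simp only [map_smul, RingHom.id_apply]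
        rw [← integral_smul]
        simp_rw [smul_comm c] }
    (∫ z, |K z|) (fun f => by
      rw [← integral_mul_const]
      refine norm_integral_le_of_norm_le (hK.norm.mul_const _) (ae_of_all _ fun z => ?_)
      rw [norm_smul, LinearIsometry.norm_map, Real.norm_eq_abs])

variable (hK : Integrable K)

theorem dilatedConv_apply (r : ℝ) (f : IntegrableSpace n) :
    dilatedConv K hK r f = ∫ z, K z • translateL1 (r • z) f := rfl

theorem norm_dilatedConv_le (r : ℝ) (f : IntegrableSpace n) :
    ‖dilatedConv K hK r f‖ ≤ (∫ z, |K z|) * ‖f‖ :=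
  ContinuousLinearMap.le_of_opNorm_le _
    (LinearMap.mkContinuous_norm_le _ (integral_nonneg fun _ => abs_nonneg _) _) f

/-- Dominated convergence with the joint continuity of translation. The scale r = 0 is included,
where the operator is multiplication by ∫ K; time 0 of the semigroup therefore needs no separate
treatment. -/
theorem continuous_dilatedConv : Continuous fun q : ℝ × IntegrableSpace n =>
    dilatedConv K hK q.1 q.2 := by
  rw [continuous_iff_continuousAt]
  intro q₀
  have hcont : ∀ z : EuclideanSpace ℝ (Fin n), Continuous fun q : ℝ × IntegrableSpace n =>
      K z • translateL1 (q.1 • z) q.2 := fun z =>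
    (continuous_translateL1.comp (f := fun q : ℝ × IntegrableSpace n => (q.1 • z, q.2))
      (by fun_prop)).const_smul (K z)
  refine continuousAt_of_dominated (bound := fun z => ‖K z‖ * (‖q₀.2‖ + 1))
    (Filter.Eventually.of_forall fun q => (integrable_smul_translateL1 hK q.1 q.2).1) ?_
    (hK.norm.mul_const _) (ae_of_all _ fun z => (hcont z).continuousAt)
  have hev : ∀ᶠ q : ℝ × IntegrableSpace n in nhds q₀, ‖q.2‖ < ‖q₀.2‖ + 1 :=
    (continuous_snd.norm.continuousAt (x := q₀)).eventually_lt continuousAt_const (by simp)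
  filter_upwards [hev] with q hq
  refine ae_of_all _ fun z => ?_
  rw [norm_smul, LinearIsometry.norm_map]
  gcongr

theorem dilatedConv_coeFn (r : ℝ) (f : IntegrableSpace n) :
    dilatedConv K hK r f =ᵐ[volume] fun x => ∫ z, K z * f (x - r • z) := by
  rw [dilatedConv_apply]
  refine coe_integral_ae_eq (integrable_smul_translateL1 hK r f)
    (F := fun z x => K z * f (x - r • z)) ?_ (ae_of_all _ fun z => ?_)
  · have h1 : AEStronglyMeasurable (fun q : EuclideanSpace ℝ (Fin n) × EuclideanSpace ℝ (Fin n) =>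
        K q.1) (volume.prod volume) := hK.1.comp_fst
    have h2 : StronglyMeasurable (fun q : EuclideanSpace ℝ (Fin n) × EuclideanSpace ℝ (Fin n) =>
        f (q.2 - r • q.1)) :=
      (Lp.stronglyMeasurable f).comp_measurable (by fun_prop)
    exact h1.mul h2.aestronglyMeasurable
  · filter_upwards [Lp.coeFn_smul (K z) (translateL1 (r • z) f),
      translateL1_coeFn (r • z) f] with x h1 h2
    rw [h1, Pi.smul_apply, h2, smul_eq_mul]

/-- Duality moves the translation from `f` to the weight, so that only the regularity of the weight
matters. -/
theorem weightedIntegral_dilatedConv {φ : EuclideanSpace ℝ (Fin n) → ℝ} (hφ : MemLp φ ∞ volume)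
    (r : ℝ) (f : IntegrableSpace n) :
    weightedIntegral φ hφ (dilatedConv K hK r f) =
      ∫ z, K z * ∫ x, φ (x + r • z) * f x := by
  rw [dilatedConv_apply, ← ContinuousLinearMap.integral_comp_comm _
    (integrable_smul_translateL1 hK r f)]
  congr 1
  ext z
  rw [map_smul, smul_eq_mul, weightedIntegral_apply]
  congr 1
  rw [← integral_sub_right_eq_self (fun x => φ (x + r • z) * f x) (r • z)]
  refine integral_congr_ae ?_
  filter_upwards [translateL1_coeFn (r • z) f] with x hx
  rw [hx, sub_add_cancel]

theorem dilatedConv_ae_abs_le {f : IntegrableSpace n} {b : ℝ}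
    (hf : ∀ᵐ x ∂(volume : Measure (EuclideanSpace ℝ (Fin n))), |f x| ≤ b) (r : ℝ) :
    ∀ᵐ x ∂(volume : Measure (EuclideanSpace ℝ (Fin n))),
      |dilatedConv K hK r f x| ≤ (∫ z, |K z|) * b := by
  rw [← integral_mul_const]
  refine ae_abs_coe_integral_le (integrable_smul_translateL1 hK r f) (hK.norm.mul_const b)
    (ae_of_all _ fun z => ?_)
  filter_upwards [Lp.coeFn_smul (K z) (translateL1 (r • z) f),
    translateL1_ae_abs_le hf (r • z)] with x h1 h2
  rw [h1, Pi.smul_apply, smul_eq_mul, abs_mul]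
  exact mul_le_mul_of_nonneg_left h2 (abs_nonneg _)

/-- Bound the kernel by its supremum and change variables in `z`; the factor r^{-n} is the Jacobian.
-/
theorem dilatedConv_ae_abs_le_norm {B : ℝ} (hB : ∀ z, |K z| ≤ B) {r : ℝ} (hr : 0 < r)
    (f : IntegrableSpace n) :
    ∀ᵐ x ∂(volume : Measure (EuclideanSpace ℝ (Fin n))),
      |dilatedConv K hK r f x| ≤ B * (r ^ n)⁻¹ * ‖f‖ := by
  filter_upwards [dilatedConv_coeFn hK r f] with x hx
  have hfi := (L1.integrable_coeFn f).norm
  have h1 : Integrable fun z => ‖f (x - r • z)‖ :=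
    (integrable_comp_smul_iff volume (fun y => ‖f (x - y)‖) hr.ne').2 (hfi.comp_sub_left x)
  have h2 : ∫ z, ‖f (x - r • z)‖ = (r ^ n)⁻¹ * ‖f‖ := by
    have := Measure.integral_comp_smul (volume : Measure (EuclideanSpace ℝ (Fin n)))
      (fun y => ‖f (x - y)‖) r
    rw [this, finrank_euclideanSpace_fin, abs_of_pos (by positivity), smul_eq_mul,
      integral_sub_left_eq_self (fun y => ‖f y‖), L1.norm_eq_integral_norm]
  rw [hx, mul_assoc, ← h2, ← integral_const_mul, ← Real.norm_eq_abs]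
  refine norm_integral_le_of_norm_le (h1.const_mul B) (ae_of_all _ fun z => ?_)
  rw [norm_mul]
  gcongr
  exact hB z

/-- The rescaled kernel `r⁻ⁿ K(x / r)`. -/
noncomputable def dilatedKernel (K : EuclideanSpace ℝ (Fin n) → ℝ) (r : ℝ)
    (x : EuclideanSpace ℝ (Fin n)) : ℝ :=
  (r ^ n)⁻¹ * K (r⁻¹ • x)

theorem integrable_dilatedKernel (hK : Integrable K) {r : ℝ} (hr : 0 < r) : Integrable (dilatedKernel K r) :=
  ((integrable_comp_smul_iff volume K (inv_ne_zero hr.ne')).2 hK).const_mul _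

theorem integral_abs_dilatedKernel {r : ℝ} (hr : 0 < r) :
    ∫ x, |dilatedKernel K r x| = ∫ x, |K x| := by
  have := Measure.integral_comp_smul (volume : Measure (EuclideanSpace ℝ (Fin n)))
    (fun x => |K x|) r⁻¹
  rw [finrank_euclideanSpace_fin, abs_of_pos (by positivity), smul_eq_mul] at this
  simp only [dilatedKernel, abs_mul, integral_const_mul]
  rw [this, abs_of_pos (by positivity), ← mul_assoc, inv_pow, mul_inv_cancel₀ (by positivity),
    one_mul]

/-- Convolution of two elements of `L¹`. -/
noncomputable def convL1 (k f : IntegrableSpace n) : IntegrableSpace n :=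
  ∫ y, k y • translateL1 y f

theorem integrable_smul_translateL1' {k : EuclideanSpace ℝ (Fin n) → ℝ} (hk : Integrable k)
    (f : IntegrableSpace n) : Integrable fun y => k y • translateL1 y f := by
  simpa using integrable_smul_translateL1 hk 1 f

theorem convL1_zero (f : IntegrableSpace n) : convL1 0 f = 0 := by
  refine integral_eq_zero_of_ae ?_
  filter_upwards [Lp.coeFn_zero ℝ 1 (volume : Measure (EuclideanSpace ℝ (Fin n)))] with y hy
  rw [hy, Pi.zero_apply, zero_smul, Pi.zero_apply]

/-- For positive scales the operator depends on `r` only through the L¹ class of the rescaled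
kernel, so operators at different times are compared through the L¹ distance of their kernels. -/
theorem dilatedConv_eq_convL1 {r : ℝ} (hr : 0 < r) {k : IntegrableSpace n}
    (hk : k =ᵐ[volume] dilatedKernel K r) (f : IntegrableSpace n) :
    dilatedConv K hK r f = convL1 k f := by
  have := Measure.integral_comp_smul (volume : Measure (EuclideanSpace ℝ (Fin n)))
    (fun y => K (r⁻¹ • y) • translateL1 y f) r
  simp only [smul_smul, inv_mul_cancel₀ hr.ne', one_smul] at this
  rw [dilatedConv_apply, this, finrank_euclideanSpace_fin, abs_of_pos (by positivity),
    ← integral_smul]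
  refine integral_congr_ae ?_
  filter_upwards [hk] with y hy
  rw [hy, smul_smul, dilatedKernel]

/-- Young's inequality for L¹ * L^∞, applied to the difference of the kernels. -/
theorem convL1_sub_ae_abs_le {f : IntegrableSpace n} {b : ℝ}
    (hf : ∀ᵐ x ∂(volume : Measure (EuclideanSpace ℝ (Fin n))), |f x| ≤ b)
    (k k' : IntegrableSpace n) :
    ∀ᵐ x ∂(volume : Measure (EuclideanSpace ℝ (Fin n))),
      |(convL1 k f - convL1 k' f : IntegrableSpace n) x| ≤ ‖k - k'‖ * b := by
  have hk := L1.integrable_coeFn k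
  have hk' := L1.integrable_coeFn k'
  have hsub : ‖k - k'‖ = ∫ y, |k y - k' y| := by
    rw [L1.norm_eq_integral_norm]
    refine integral_congr_ae ?_
    filter_upwards [Lp.coeFn_sub k k'] with y hy
    rw [hy, Pi.sub_apply, Real.norm_eq_abs]
  rw [convL1, convL1, ← integral_sub (integrable_smul_translateL1' hk f)
    (integrable_smul_translateL1' hk' f), hsub, ← integral_mul_const]
  simp_rw [← sub_smul]
  refine ae_abs_coe_integral_le (integrable_smul_translateL1' (hk.sub hk') f)
    ((hk.sub hk').norm.mul_const b) (ae_of_all _ fun z => ?_)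
  filter_upwards [Lp.coeFn_smul (k z - k' z) (translateL1 z f), translateL1_ae_abs_le hf z]
    with x h1 h2
  rw [Pi.sub_apply, h1, Pi.smul_apply, smul_eq_mul, abs_mul]
  exact mul_le_mul_of_nonneg_left h2 (abs_nonneg _)

/-- Rescaled kernels depend continuously on the scale in `L¹`. -/
theorem continuousOn_dilatedKernel (hK : Integrable K) (hc : Continuous K) {C : ℝ}
    (hdec : ∀ x, (1 + ‖x‖) ^ (n + 1) * |K x| ≤ C) :
    ∃ k : ℝ → IntegrableSpace n, ContinuousOn k (Ioi 0) ∧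
      ∀ r > 0, k r =ᵐ[volume] dilatedKernel K r := by
  classical
  refine ⟨fun r => if h : 0 < r then (integrable_dilatedKernel hK h).toL1 _ else 0, ?_, ?_⟩
  swap
  · intro r hr
    have hr' : 0 < r := hr
    simp only [hr', ↓reduceDIte]
    exact Integrable.coeFn_toL1 _
  intro r₀ hr₀
  have hr₀' : (0 : ℝ) < r₀ := hr₀
  refine ContinuousAt.continuousWithinAt ?_
  rw [ContinuousAt, tendsto_iff_norm_sub_tendsto_zero, dif_pos hr₀']
  have hnear : ∀ᶠ r in nhds r₀, r ∈ Ioo (r₀ / 2) (2 * r₀) :=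
    Ioo_mem_nhds (by linarith) (by linarith)
  have hlim : Filter.Tendsto (fun r => ∫ x, |dilatedKernel K r x - dilatedKernel K r₀ x|)
      (nhds r₀) (nhds (∫ x : EuclideanSpace ℝ (Fin n), 0)) := by
    have hint : Integrable fun x : EuclideanSpace ℝ (Fin n) =>
        (1 + ‖(2 * r₀)⁻¹ • x‖) ^ (-((n : ℝ) + 1)) :=
      (integrable_comp_smul_iff volume (fun x : EuclideanSpace ℝ (Fin n) =>
        (1 + ‖x‖) ^ (-((n : ℝ) + 1))) (by positivity)).2
        (integrable_one_add_norm (by rw [finrank_euclideanSpace_fin]; linarith))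
    -- A majorant uniform in r: the prefactor is largest at the lower scale r₀/2, the tail at the
    -- upper scale 2r₀.
    have hb : ∀ r ∈ Ioo (r₀ / 2) (2 * r₀), ∀ x, |dilatedKernel K r x| ≤
        ((r₀ / 2) ^ n)⁻¹ * (C * (1 + ‖(2 * r₀)⁻¹ • x‖) ^ (-((n : ℝ) + 1))) := by
      intro r hr x
      have hrpos : 0 < r := by linarith [hr.1]
      have hCn : 0 ≤ C := le_trans (by positivity) (hdec 0)
      rw [dilatedKernel, abs_mul, abs_of_pos (by positivity : 0 < (r ^ n)⁻¹)]
      have h1 : |K (r⁻¹ • x)| ≤ C * (1 + ‖r⁻¹ • x‖) ^ (-((n : ℝ) + 1)) := by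
        rw [Real.rpow_neg (by positivity), ← div_eq_mul_inv, le_div_iff₀ (by positivity), mul_comm]
        exact_mod_cast hdec (r⁻¹ • x)
      have h2 : (1 + ‖r⁻¹ • x‖) ^ (-((n : ℝ) + 1)) ≤
          (1 + ‖(2 * r₀)⁻¹ • x‖) ^ (-((n : ℝ) + 1)) := by
        refine Real.rpow_le_rpow_of_nonpos (by positivity) ?_ (by linarith)
        rw [norm_smul, norm_smul, Real.norm_eq_abs, Real.norm_eq_abs,
          abs_of_pos (by positivity), abs_of_pos (by positivity)]
        gcongr
        exact hr.2.le
      gcongr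
      · exact hr.1.le
      · exact h1.trans (by gcongr)
    refine tendsto_integral_filter_of_dominated_convergence (fun x =>
        2 * (((r₀ / 2) ^ n)⁻¹ * (C * (1 + ‖(2 * r₀)⁻¹ • x‖) ^ (-((n : ℝ) + 1))))) ?_ ?_
      (((hint.const_mul _).const_mul _).const_mul _) (ae_of_all _ fun x => ?_)
    · refine Filter.Eventually.of_forall fun r => Continuous.aestronglyMeasurable ?_
      unfold dilatedKernel
      fun_prop
    · filter_upwards [hnear] with r hr
      refine ae_of_all _ fun x => ?_
      rw [Real.norm_eq_abs, abs_abs]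
      have h1 := hb r hr x
      have h2 := hb r₀ ⟨by linarith, by linarith⟩ x
      linarith [abs_sub (dilatedKernel K r x) (dilatedKernel K r₀ x)]
    · have hcr : ContinuousAt (fun r => |dilatedKernel K r x - dilatedKernel K r₀ x|) r₀ := by
        have : ContinuousAt (fun r : ℝ => r⁻¹) r₀ := continuousAt_inv₀ hr₀'.ne'
        have h3 : ContinuousAt (fun r : ℝ => (r ^ n)⁻¹) r₀ :=
          (continuousAt_id.pow n).inv₀ (pow_pos hr₀' n).ne'
        have h4 : ContinuousAt (fun r : ℝ => K (r⁻¹ • x)) r₀ :=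
          hc.continuousAt.comp (f := fun r : ℝ => r⁻¹ • x) (this.smul continuousAt_const)
        exact ((h3.mul h4).sub continuousAt_const).abs
      simpa [ContinuousAt] using hcr
  rw [integral_zero] at hlim
  refine hlim.congr' ?_
  filter_upwards [hnear] with r hr
  have hrpos : 0 < r := by linarith [hr.1]
  rw [dif_pos hrpos, ← Integrable.toL1_sub, L1.norm_eq_integral_norm]
  refine integral_congr_ae ?_
  filter_upwards [Integrable.coeFn_toL1 ((integrable_dilatedKernel hK hrpos).sub
    (integrable_dilatedKernel hK hr₀'))] with x hx
  rw [hx, Pi.sub_apply, Real.norm_eq_abs]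

end Convolution

/-! ### The truncated power as a Lipschitz map of L¹. -/

section Nonlinearity

theorem abs_rpow_sub_rpow_le {p b : ℝ} (hp : 1 < p) {s t : ℝ} (hs : s ∈ Icc 0 b)
    (ht : t ∈ Icc 0 b) : |s ^ p - t ^ p| ≤ p * b ^ (p - 1) * |s - t| := by
  refine (convex_Icc 0 b).norm_image_sub_le_of_norm_hasDerivWithin_le (f := fun x : ℝ => x ^ p)
    (f' := fun x => p * x ^ (p - 1))
    (fun x _ => (Real.hasDerivAt_rpow_const (Or.inr hp.le)).hasDerivWithinAt) (fun x hx => ?_) ht hs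
  have := Real.rpow_nonneg hx.1 (p - 1)
  rw [Real.norm_of_nonneg (by positivity)]
  have := Real.rpow_le_rpow hx.1 hx.2 (by linarith : 0 ≤ p - 1)
  gcongr

/-- The power `|x|^p`, truncated at `|x| = b`. -/
noncomputable def truncPow (p b x : ℝ) : ℝ := (min |x| b) ^ p

theorem truncPow_eq {p b x : ℝ} (hx : |x| ≤ b) : truncPow p b x = |x| ^ p := by
  rw [truncPow, min_eq_left hx]

theorem truncPow_nonneg {p b : ℝ} (hb : 0 ≤ b) (x : ℝ) : 0 ≤ truncPow p b x :=
  Real.rpow_nonneg (le_min (abs_nonneg x) hb) p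

theorem truncPow_le {p b : ℝ} (hp : 1 < p) (hb : 0 ≤ b) (x : ℝ) : truncPow p b x ≤ b ^ p :=
  Real.rpow_le_rpow (le_min (abs_nonneg x) hb) (min_le_right _ _) (by linarith)

/-- The power |x|^p does not act on L¹. Its truncation is globally Lipschitz and vanishes at 0,
hence acts by composition. -/
theorem lipschitzWith_truncPow {p b : ℝ} (hp : 1 < p) (hb : 0 ≤ b) :
    LipschitzWith (p * b ^ (p - 1)).toNNReal (truncPow p b) := by
  have hnn : 0 ≤ p * b ^ (p - 1) := mul_nonneg (by linarith) (Real.rpow_nonneg hb _)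
  refine LipschitzWith.of_dist_le_mul fun x y => ?_
  rw [Real.coe_toNNReal _ hnn, Real.dist_eq, Real.dist_eq]
  refine (abs_rpow_sub_rpow_le hp ⟨le_min (abs_nonneg x) hb, min_le_right _ _⟩
    ⟨le_min (abs_nonneg y) hb, min_le_right _ _⟩).trans ?_
  refine mul_le_mul_of_nonneg_left ?_ hnn
  have h1 := abs_min_sub_min_le_max |x| b |y| b
  rw [sub_self, abs_zero, max_eq_left (abs_nonneg _)] at h1
  exact h1.trans (abs_abs_sub_abs_le x y)

theorem truncPow_zero {p b : ℝ} (hp : 1 < p) (hb : 0 ≤ b) : truncPow p b 0 = 0 := by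
  rw [truncPow, abs_zero, min_eq_left hb, Real.zero_rpow (by linarith)]

variable {n : ℕ} {p b : ℝ} (hp : 1 < p) (hb : 0 ≤ b)

/-- The superposition operator of the truncated power on `L¹`. -/
noncomputable def truncPowL1 (f : IntegrableSpace n) : IntegrableSpace n :=
  (lipschitzWith_truncPow hp hb).compLp (truncPow_zero hp hb) f

theorem truncPowL1_coeFn (f : IntegrableSpace n) :
    truncPowL1 hp hb f =ᵐ[volume] fun x => truncPow p b (f x) :=
  LipschitzWith.coeFn_compLp _ _ f

theorem truncPowL1_coeFn_of_le {f : IntegrableSpace n}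
    (hf : ∀ᵐ x ∂(volume : Measure (EuclideanSpace ℝ (Fin n))), |f x| ≤ b) :
    truncPowL1 hp hb f =ᵐ[volume] fun x => |f x| ^ p := by
  filter_upwards [truncPowL1_coeFn hp hb f, hf] with x h1 h2
  rw [h1, truncPow_eq h2]

theorem truncPowL1_ae_abs_le (f : IntegrableSpace n) :
    ∀ᵐ x ∂(volume : Measure (EuclideanSpace ℝ (Fin n))), |truncPowL1 hp hb f x| ≤ b ^ p := by
  filter_upwards [truncPowL1_coeFn hp hb f] with x h1
  rw [h1, abs_of_nonneg (truncPow_nonneg hb _)]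
  exact truncPow_le hp hb _

theorem truncPowL1_ae_nonneg (f : IntegrableSpace n) :
    ∀ᵐ x ∂(volume : Measure (EuclideanSpace ℝ (Fin n))), 0 ≤ truncPowL1 hp hb f x := by
  filter_upwards [truncPowL1_coeFn hp hb f] with x h1
  rw [h1]
  exact truncPow_nonneg hb _

/-- The truncation level may be lowered to any essential bound of `f`. With time-dependent bounds,
the Lipschitz constant then inherits their decay. -/
theorem truncPowL1_eq {b' : ℝ} (hb' : 0 ≤ b') (hbb : b ≤ b') {f : IntegrableSpace n}
    (hf : ∀ᵐ x ∂(volume : Measure (EuclideanSpace ℝ (Fin n))), |f x| ≤ b) :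
    truncPowL1 hp hb' f = truncPowL1 hp hb f := by
  refine Lp.ext ?_
  exact (truncPowL1_coeFn_of_le hp hb' (hf.mono fun x hx => hx.trans hbb)).trans
    (truncPowL1_coeFn_of_le hp hb hf).symm

theorem norm_truncPowL1_sub_le (f g : IntegrableSpace n) :
    ‖truncPowL1 hp hb f - truncPowL1 hp hb g‖ ≤ p * b ^ (p - 1) * ‖f - g‖ := by
  have := LipschitzWith.norm_compLp_sub_le (lipschitzWith_truncPow hp hb) (truncPow_zero hp hb) f g
  rwa [Real.coe_toNNReal _ (mul_nonneg (by linarith) (Real.rpow_nonneg hb _))] at this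

theorem norm_truncPowL1_le (f : IntegrableSpace n) :
    ‖truncPowL1 hp hb f‖ ≤ p * b ^ (p - 1) * ‖f‖ := by
  have := LipschitzWith.norm_compLp_le (lipschitzWith_truncPow hp hb) (truncPow_zero hp hb) f
  rwa [Real.coe_toNNReal _ (mul_nonneg (by linarith) (Real.rpow_nonneg hb _))] at this

theorem continuous_truncPowL1 : Continuous (truncPowL1 (n := n) hp hb) :=
  LipschitzWith.continuous_compLp (lipschitzWith_truncPow hp hb) (truncPow_zero hp hb)

end Nonlinearity

/-! ### The semigroup and the Duhamel term on L¹. -/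

section Operators

variable {n m : ℕ} (hm : 1 ≤ m)

/-- The semigroup `exp (-t (-Δ)^m)` as a bounded operator on `L¹`. -/
noncomputable def polyOp (t : ℝ) : IntegrableSpace n →L[ℝ] IntegrableSpace n :=
  dilatedConv (polyKernel n m 1) (polyKernel_integrable n m hm) (t ^ (1 / (2 * m : ℝ)))

theorem continuous_polyOp : Continuous fun q : ℝ × IntegrableSpace n => polyOp hm q.1 q.2 := by
  have h : Continuous fun t : ℝ => t ^ (1 / (2 * m : ℝ)) :=
    Real.continuous_rpow_const (by positivity)
  simp only [polyOp]
  exact (continuous_dilatedConv (polyKernel_integrable n m hm)).comp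
    (f := fun q : ℝ × IntegrableSpace n => (q.1 ^ (1 / (2 * m : ℝ)), q.2))
    ((h.comp continuous_fst).prodMk continuous_snd)

theorem polyOp_coeFn {t : ℝ} (ht : 0 ≤ t) (f : IntegrableSpace n) :
    polyOp hm t f =ᵐ[volume] polySemigroup n m t f := by
  have h : polySemigroup n m t f = fun x =>
      ∫ z, polyKernel n m 1 z * f (x - t ^ (1 / (2 * m : ℝ)) • z) :=
    funext fun x => polySemigroup_eq n m hm ht f x
  rw [h, polyOp]
  exact dilatedConv_coeFn (polyKernel_integrable n m hm) (t ^ (1 / (2 * m : ℝ))) f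

theorem polySemigroup_congr {t : ℝ} (ht : t ≠ 0) {f g : EuclideanSpace ℝ (Fin n) → ℝ}
    (h : f =ᵐ[volume] g) (x : EuclideanSpace ℝ (Fin n)) :
    polySemigroup n m t f x = polySemigroup n m t g x := by
  rw [polySemigroup, polySemigroup, if_neg ht, if_neg ht]
  refine integral_congr_ae ?_
  filter_upwards [h] with y hy
  rw [hy]

theorem polySemigroup_ae_congr {t : ℝ} {f g : EuclideanSpace ℝ (Fin n) → ℝ}
    (h : f =ᵐ[volume] g) : polySemigroup n m t f =ᵐ[volume] polySemigroup n m t g := by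
  rcases eq_or_ne t 0 with rfl | ht
  · filter_upwards [h] with x hx
    simp [polySemigroup, hx]
  · exact ae_of_all _ (polySemigroup_congr ht h)

theorem polySemigroup_eq_integral_dilatedKernel (hm : 1 ≤ m) {t : ℝ} (ht : 0 < t)
    (f : EuclideanSpace ℝ (Fin n) → ℝ) (x : EuclideanSpace ℝ (Fin n)) :
    polySemigroup n m t f x =
      ∫ y, dilatedKernel (polyKernel n m 1) (t ^ (1 / (2 * m : ℝ))) (x - y) * f y := by
  have hm' : (0 : ℝ) < 2 * m := by positivity
  have hr : 0 < t ^ (1 / (2 * m : ℝ)) := Real.rpow_pos_of_pos ht _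
  have hrt : t = (t ^ (1 / (2 * m : ℝ))) ^ (2 * m) := by
    rw [← Real.rpow_natCast, ← Real.rpow_mul ht.le]
    push_cast
    rw [one_div, inv_mul_cancel₀ hm'.ne', Real.rpow_one]
  have hk : polyKernel n m t = dilatedKernel (polyKernel n m 1) (t ^ (1 / (2 * m : ℝ))) := by
    funext y
    conv_lhs => rw [hrt]
    rw [polyKernel_scale n m hr, dilatedKernel]
  rw [polySemigroup, if_neg ht.ne', hk]

/-- Pairings of `L¹`-convergent functions with boundedly convergent weights converge. -/
theorem tendsto_integral_mul_of_bounded {X ι : Type*} [MeasurableSpace X] {μ : Measure X}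
    {l : Filter ι} [l.IsCountablyGenerated] {φ : ι → X → ℝ} {φ₀ : X → ℝ} {f : ι → Lp ℝ 1 μ}
    {f₀ : Lp ℝ 1 μ} {B : ℝ} (hφ : ∀ i, AEStronglyMeasurable (φ i) μ)
    (hB : ∀ᶠ i in l, ∀ x, |φ i x| ≤ B) (hlim : ∀ x, Filter.Tendsto (fun i => φ i x) l (nhds (φ₀ x)))
    (hf : Filter.Tendsto f l (nhds f₀)) :
    Filter.Tendsto (fun i => ∫ x, φ i x * f i x ∂μ) l (nhds (∫ x, φ₀ x * f₀ x ∂μ)) := by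
  have h1 : Filter.Tendsto (fun i => ∫ x, φ i x * f₀ x ∂μ) l (nhds (∫ x, φ₀ x * f₀ x ∂μ)) := by
    refine tendsto_integral_filter_of_dominated_convergence (fun x => B * ‖f₀ x‖)
      (Filter.Eventually.of_forall fun i => (hφ i).mul (Lp.aestronglyMeasurable f₀)) ?_
      ((L1.integrable_coeFn f₀).norm.const_mul B)
      (ae_of_all _ fun x => (hlim x).mul tendsto_const_nhds)
    filter_upwards [hB] with i hi
    refine ae_of_all _ fun x => ?_
    rw [norm_mul]
    exact mul_le_mul_of_nonneg_right (hi x) (norm_nonneg _)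
  have h2 : Filter.Tendsto (fun i => ∫ x, φ i x * f i x ∂μ - ∫ x, φ i x * f₀ x ∂μ) l (nhds 0) := by
    have hn : Filter.Tendsto (fun i => B * ‖f i - f₀‖) l (nhds 0) := by
      have := (tendsto_iff_norm_sub_tendsto_zero.1 hf).const_mul B
      rwa [mul_zero] at this
    refine squeeze_zero_norm' ?_ hn
    filter_upwards [hB] with i hi
    have hint : ∀ g : Lp ℝ 1 μ, Integrable (fun x => φ i x * g x) μ := fun g =>
      (L1.integrable_coeFn g).bdd_mul (hφ i) (ae_of_all _ hi)
    rw [← integral_sub (hint _) (hint _), L1.norm_eq_integral_norm, ← integral_const_mul]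
    refine norm_integral_le_of_norm_le ((L1.integrable_coeFn _).norm.const_mul B) ?_
    filter_upwards [Lp.coeFn_sub (f i) f₀] with x hx
    rw [hx, Pi.sub_apply, ← mul_sub, norm_mul]
    exact mul_le_mul_of_nonneg_right (hi x) (norm_nonneg _)
  simpa using h2.add h1

/-- Supplies the joint measurability in (s, x) that identifies the Bochner integral of `duhamel`
with the pointwise time integral. The kernel degenerates at s = t, which is excluded. -/
theorem continuousOn_polySemigroup (hm : 1 ≤ m) {F : ℝ → IntegrableSpace n} (hF : Continuous F) (t : ℝ) :
    ContinuousOn (fun q : ℝ × EuclideanSpace ℝ (Fin n) => polySemigroup n m (t - q.1) (F q.1) q.2)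
      (Iio t ×ˢ univ) := by
  obtain ⟨B, -, hB⟩ := polyKernel_decay n m hm 0
  simp only [pow_zero, one_mul] at hB
  have hc := polyKernel_continuous n m hm
  have hsub : ContinuousOn (fun q : ℝ × EuclideanSpace ℝ (Fin n) =>
      ∫ y, dilatedKernel (polyKernel n m 1) ((t - q.1) ^ (1 / (2 * m : ℝ))) (q.2 - y) * F q.1 y)
      (Iio t ×ˢ univ) := by
    rintro ⟨s₀, x₀⟩ ⟨hs₀ : s₀ < t, -⟩
    have hr₀ : 0 < (t - s₀) ^ (1 / (2 * m : ℝ)) := Real.rpow_pos_of_pos (sub_pos.2 hs₀) _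
    have hr : Continuous fun q : ℝ × EuclideanSpace ℝ (Fin n) => (t - q.1) ^ (1 / (2 * m : ℝ)) :=
      (Real.continuous_rpow_const (by positivity)).comp (by fun_prop)
    have hri : ContinuousAt (fun q : ℝ × EuclideanSpace ℝ (Fin n) =>
        (((t - q.1) ^ (1 / (2 * m : ℝ))) ^ n)⁻¹) (s₀, x₀) :=
      (hr.pow n).continuousAt.inv₀ (pow_pos hr₀ n).ne'
    refine ContinuousAt.continuousWithinAt ?_
    refine tendsto_integral_mul_of_bounded
      (B := ((((t - s₀) ^ (1 / (2 * m : ℝ))) ^ n)⁻¹ + 1) * B) (fun q => ?_) ?_ (fun y => ?_)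
      (hF.comp continuous_fst).continuousAt
    · refine Continuous.aestronglyMeasurable ?_
      unfold dilatedKernel
      fun_prop
    · have hpos : ∀ᶠ q : ℝ × EuclideanSpace ℝ (Fin n) in nhds (s₀, x₀), q.1 < t :=
        continuous_fst.continuousAt.eventually_lt continuousAt_const hs₀
      filter_upwards [hri.eventually_lt continuousAt_const (lt_add_one _), hpos] with q hq hqt y
      have hrq : 0 < (t - q.1) ^ (1 / (2 * m : ℝ)) := Real.rpow_pos_of_pos (sub_pos.2 hqt) _
      rw [dilatedKernel, abs_mul, abs_of_pos (by positivity)]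
      exact mul_le_mul hq.le (hB _) (abs_nonneg _) (by positivity)
    · refine hri.mul (hc.continuousAt.comp' ?_)
      exact (hr.continuousAt.inv₀ hr₀.ne').smul (by fun_prop)
  refine hsub.congr ?_
  rintro ⟨s, x⟩ ⟨hs : s < t, -⟩
  exact polySemigroup_eq_integral_dilatedKernel hm (sub_pos.2 hs) _ _

/-- The Duhamel integral of a forcing term, as a Bochner integral in `L¹`. -/
noncomputable def duhamel (F : ℝ → IntegrableSpace n) (t : ℝ) : IntegrableSpace n :=
  ∫ s in (0 : ℝ)..t, polyOp hm (t - s) (F s)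

theorem continuous_polyOp_comp {F : ℝ → IntegrableSpace n} (hF : Continuous F) :
    Continuous fun q : ℝ × ℝ => polyOp hm (q.1 - q.2) (F q.2) :=
  (continuous_polyOp hm).comp (f := fun q : ℝ × ℝ => (q.1 - q.2, F q.2)) (by fun_prop)

theorem continuous_polyOp_comp_right {F : ℝ → IntegrableSpace n} (hF : Continuous F) (t : ℝ) :
    Continuous fun s : ℝ => polyOp hm (t - s) (F s) :=
  (continuous_polyOp hm).comp (f := fun s : ℝ => (t - s, F s)) (by fun_prop)

theorem continuous_duhamel {F : ℝ → IntegrableSpace n} (hF : Continuous F) :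
    Continuous (duhamel hm F) :=
  intervalIntegral.continuous_parametric_intervalIntegral_of_continuous
    (f := fun t s => polyOp hm (t - s) (F s)) (continuous_polyOp_comp hm hF) continuous_id

theorem duhamel_congr {F G : ℝ → IntegrableSpace n} {t : ℝ} (ht : 0 ≤ t)
    (h : EqOn F G (Icc 0 t)) : duhamel hm F t = duhamel hm G t := by
  refine intervalIntegral.integral_congr fun s hs => ?_
  rw [uIcc_of_le ht] at hs
  simp only [h hs]

theorem duhamel_coeFn {F : ℝ → IntegrableSpace n} (hF : Continuous F) {t : ℝ} (ht : 0 ≤ t) :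
    duhamel hm F t =ᵐ[volume] fun x => ∫ s in (0 : ℝ)..t, polySemigroup n m (t - s) (F s) x := by
  simp_rw [duhamel, intervalIntegral.integral_of_le ht]
  refine coe_integral_ae_eq (F := fun s x => polySemigroup n m (t - s) (F s) x)
    ((continuous_polyOp_comp_right hm hF t).integrableOn_Ioc) ?_ ?_
  -- The endpoint s = t is null, and joint continuity holds only for s < t.
  · rw [← restrict_Ioo_eq_restrict_Ioc]
    have := ((continuousOn_polySemigroup hm hF t).mono
      (prod_mono_left (s₁ := Ioo 0 t) fun s hs => hs.2)).aestronglyMeasurable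
      (μ := (volume : Measure ℝ).prod volume) (measurableSet_Ioo.prod MeasurableSet.univ)
    rwa [← Measure.prod_restrict, Measure.restrict_univ] at this
  · filter_upwards [ae_restrict_mem measurableSet_Ioc] with s hs
    exact polyOp_coeFn hm (sub_nonneg.2 hs.2) (F s)

end Operators

/-- An integral form of Grönwall's inequality with zero initial value. -/
theorem le_zero_of_le_mul_integral {d : ℝ → ℝ} (hd : Continuous d) {L T : ℝ} (hL : 0 ≤ L)
    (h : ∀ t ∈ Icc 0 T, d t ≤ L * ∫ s in (0 : ℝ)..t, d s) {t : ℝ} (ht : t ∈ Icc 0 T) :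
    d t ≤ 0 := by
  have hE : ∀ t, HasDerivAt (fun t => ∫ s in (0 : ℝ)..t, d s) (d t) t := fun t =>
    intervalIntegral.integral_hasDerivAt_right (hd.intervalIntegrable _ _)
      (hd.stronglyMeasurableAtFilter _ _) hd.continuousAt
  have hg : ∀ t, HasDerivAt (fun t => (∫ s in (0 : ℝ)..t, d s) * Real.exp (-L * t))
      (d t * Real.exp (-L * t) + (∫ s in (0 : ℝ)..t, d s) * (Real.exp (-L * t) * -L)) t :=
    fun t => (hE t).mul (by simpa using ((hasDerivAt_id t).const_mul (-L)).exp)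
  -- The primitive of d times e^{-Lt} is nonincreasing and vanishes at 0, so the primitive is
  -- nonpositive.
  have hanti : AntitoneOn (fun t => (∫ s in (0 : ℝ)..t, d s) * Real.exp (-L * t)) (Icc 0 T) := by
    refine antitoneOn_of_deriv_nonpos (convex_Icc 0 T)
      (fun t _ => (hg t).continuousAt.continuousWithinAt)
      (fun t _ => (hg t).differentiableAt.differentiableWithinAt) fun t ht => ?_
    rw [interior_Icc] at ht
    rw [(hg t).deriv]
    have := h t (Ioo_subset_Icc_self ht)
    have hexp := Real.exp_pos (-L * t)
    nlinarith
  have h0 := hanti ⟨le_rfl, ht.1.trans ht.2⟩ ht ht.1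
  simp only [intervalIntegral.integral_same, zero_mul] at h0
  have hE0 : ∫ s in (0 : ℝ)..t, d s ≤ 0 := nonpos_of_mul_nonpos_left h0 (Real.exp_pos _)
  exact (h t ht).trans (mul_nonpos_of_nonneg_of_nonpos hL hE0)

/-! ### The Duhamel equation in L¹ and uniqueness. -/

section Mild

variable {n m : ℕ} (hm : 1 ≤ m)

theorem norm_polyOp_le (t : ℝ) (f : IntegrableSpace n) :
    ‖polyOp hm t f‖ ≤ (∫ z, |polyKernel n m 1 z|) * ‖f‖ :=
  norm_dilatedConv_le _ _ f

theorem duhamel_sub {F G : ℝ → IntegrableSpace n} (hF : Continuous F) (hG : Continuous G) (t : ℝ) :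
    duhamel hm F t - duhamel hm G t = duhamel hm (fun s => F s - G s) t := by
  rw [duhamel, duhamel, ← intervalIntegral.integral_sub
    ((continuous_polyOp_comp_right hm hF t).intervalIntegrable _ _)
    ((continuous_polyOp_comp_right hm hG t).intervalIntegrable _ _)]
  simp only [duhamel, map_sub]

theorem norm_duhamel_le {F : ℝ → IntegrableSpace n} {b : ℝ → ℝ} {t : ℝ} (ht : 0 ≤ t)
    (hF : ∀ s ∈ Icc 0 t, ‖F s‖ ≤ b s) (hb : IntervalIntegrable b volume 0 t) :
    ‖duhamel hm F t‖ ≤ (∫ z, |polyKernel n m 1 z|) * ∫ s in (0 : ℝ)..t, b s := by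
  rw [← intervalIntegral.integral_const_mul]
  refine intervalIntegral.norm_integral_le_of_norm_le ht (ae_of_all _ fun s hs => ?_)
    (hb.const_mul _)
  refine (norm_polyOp_le hm _ _).trans ?_
  exact mul_le_mul_of_nonneg_left (hF s (Ioc_subset_Icc_self hs))
    (integral_nonneg fun _ => abs_nonneg _)

/-- The class bounds u(t) only for almost every t. The L^∞ ball is closed in L¹ and u is
L¹-continuous, so a violation at one t would persist on an interval to its right, a set of positive
measure. This also covers t = 0. -/
theorem InSolutionClass.exists_bound {T : ℝ} {u : ℝ → IntegrableSpace n}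
    (hu : InSolutionClass n T u) : ∃ M : ℝ, 0 ≤ M ∧ ∀ t ∈ Ico 0 T,
      ∀ᵐ x ∂(volume : Measure (EuclideanSpace ℝ (Fin n))), |u t x| ≤ M := by
  obtain ⟨hc, w, hw, hwu⟩ := hu
  refine ⟨(eLpNorm w ∞ (volume.restrict (Ioo 0 T))).toReal, ENNReal.toReal_nonneg, ?_⟩
  set M := (eLpNorm w ∞ (volume.restrict (Ioo 0 T))).toReal with hM
  have hgood : ∀ᵐ s ∂(volume.restrict (Ioo 0 T)),
      u s ∈ {f : IntegrableSpace n | ∀ᵐ x ∂volume, |f x| ≤ M} := by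
    have hle := ae_le_eLpNormEssSup (f := w) (μ := volume.restrict (Ioo 0 T))
    filter_upwards [hwu, hle] with s hs hle
    have h1 : ‖w s‖ ≤ M := by
      rw [← eLpNorm_exponent_top] at hle
      have := ENNReal.toReal_mono hw.2.ne hle
      rwa [toReal_enorm] at this
    have h2 : ∀ᵐ x ∂volume, ‖w s x‖ ≤ ‖w s‖ := by
      have h3 := ae_le_eLpNormEssSup (f := w s) (μ := volume)
      filter_upwards [h3] with x hx
      rw [← eLpNorm_exponent_top] at hx
      simpa [Lp.norm_def] using ENNReal.toReal_mono (Lp.memLp (w s)).2.ne hx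
    filter_upwards [hs, h2] with x hx h2
    rw [← hx]
    exact h2.trans h1
  intro t ht
  change u t ∈ {f : IntegrableSpace n | ∀ᵐ x ∂volume, |f x| ≤ M}
  by_contra hnot
  have hev : ∀ᶠ s in nhdsWithin t (Ioi t), u s ∉ {f : IntegrableSpace n | ∀ᵐ x ∂volume, |f x| ≤ M} := by
    have h1 : ContinuousWithinAt u (Ioo t T) t :=
      (hc t ht).mono fun s hs => ⟨ht.1.trans hs.1.le, hs.2⟩
    rw [← nhdsWithin_Ioo_eq_nhdsGT ht.2]
    exact h1.eventually ((isClosed_ae_abs_le M).isOpen_compl.mem_nhds hnot)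
  obtain ⟨b, hb, hsub⟩ := (mem_nhdsGT_iff_exists_Ioo_subset' ht.2).1 hev
  have hb' : t < b := hb
  rw [ae_restrict_iff' measurableSet_Ioo, ae_iff] at hgood
  have hpos : 0 < volume (Ioo t (min b T)) := by
    rw [Real.volume_Ioo, ENNReal.ofReal_pos, sub_pos]
    exact lt_min hb' ht.2
  refine hpos.ne' (measure_mono_null (fun s hs => ?_) hgood)
  simp only [mem_ofPred_eq, Classical.not_imp]
  exact ⟨⟨ht.1.trans_lt hs.1, hs.2.trans_le (min_le_right _ _)⟩,
    hsub ⟨hs.1, hs.2.trans_le (min_le_left _ _)⟩⟩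

variable {p : ℝ} (hp : 1 < p)

/-- Constant extension beyond [0,t] gives a path continuous on all of ℝ, as the Duhamel lemmas
require; values outside [0,t] do not affect the Duhamel term there. -/
theorem continuous_IccExtend_of_continuousOn {T t : ℝ} {u : ℝ → IntegrableSpace n}
    (hu : ContinuousOn u (Ico 0 T)) (ht : t ∈ Ico 0 T) :
    Continuous (IccExtend ht.1 (domRestrict (Icc 0 t) u)) :=
  (continuousOn_iff_continuous_domRestrict.1
    (hu.mono fun _ hs => ⟨hs.1, hs.2.trans_lt ht.2⟩)).Icc_extend'

theorem IccExtend_domRestrict_eqOn {t : ℝ} (ht : 0 ≤ t) (u : ℝ → IntegrableSpace n) :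
    EqOn (IccExtend ht (domRestrict (Icc 0 t) u)) u (Icc 0 t) := fun s hs => by
  rw [IccExtend_of_mem _ _ hs, domRestrict_apply]

/-- The pointwise Duhamel formula is an identity between Bochner integrals in `L¹`. -/
theorem mild_formula_iff {T M ε : ℝ} (hM : 0 ≤ M) {u : ℝ → IntegrableSpace n}
    (hu : ContinuousOn u (Ico 0 T))
    (hb : ∀ t ∈ Ico 0 T, ∀ᵐ x ∂(volume : Measure (EuclideanSpace ℝ (Fin n))), |u t x| ≤ M)
    {u₀ : EuclideanSpace ℝ (Fin n) → ℝ} {U : IntegrableSpace n} (hU : U =ᵐ[volume] u₀)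
    {t : ℝ} (ht : t ∈ Ico 0 T) :
    (∀ᵐ x ∂(volume : Measure (EuclideanSpace ℝ (Fin n))),
      u t x = ε * polySemigroup n m t u₀ x +
        ∫ s in (0 : ℝ)..t, polySemigroup n m (t - s) (fun y => |u s y| ^ p) x) ↔
      u t = ε • polyOp hm t U + duhamel hm (fun s => truncPowL1 hp hM (u s)) t := by
  have hD : duhamel hm (fun s => truncPowL1 hp hM (u s)) t =ᵐ[volume] fun x =>
      ∫ s in (0 : ℝ)..t, polySemigroup n m (t - s) (fun y => |u s y| ^ p) x := by
    have heq := IccExtend_domRestrict_eqOn ht.1 u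
    rw [duhamel_congr hm (G := fun s => truncPowL1 hp hM
      (IccExtend ht.1 (domRestrict (Icc 0 t) u) s)) ht.1 (fun s hs => by simp only [heq hs])]
    refine (duhamel_coeFn hm ((continuous_truncPowL1 hp hM).comp
      (continuous_IccExtend_of_continuousOn hu ht)) ht.1).trans (ae_of_all _ fun x => ?_)
    simp only [Function.comp_apply]
    -- At s = t the semigroup is the identity and equality in x holds only almost everywhere; on the
    -- open interval it holds at every x.
    rw [intervalIntegral.integral_of_le ht.1, intervalIntegral.integral_of_le ht.1,
      integral_Ioc_eq_integral_Ioo, integral_Ioc_eq_integral_Ioo]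
    refine setIntegral_congr_fun measurableSet_Ioo fun s hs => ?_
    rw [heq (Ioo_subset_Icc_self hs)]
    exact polySemigroup_congr (sub_pos.2 hs.2).ne'
      (truncPowL1_coeFn_of_le hp hM (hb s ⟨hs.1.le, hs.2.trans ht.2⟩)) x
  have hR : (ε • polyOp hm t U + duhamel hm (fun s => truncPowL1 hp hM (u s)) t :
      IntegrableSpace n) =ᵐ[volume] fun x => ε * polySemigroup n m t u₀ x +
        ∫ s in (0 : ℝ)..t, polySemigroup n m (t - s) (fun y => |u s y| ^ p) x := by
    filter_upwards [hD, Lp.coeFn_add (ε • polyOp hm t U)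
      (duhamel hm (fun s => truncPowL1 hp hM (u s)) t), Lp.coeFn_smul ε (polyOp hm t U),
      polyOp_coeFn hm ht.1 U, polySemigroup_ae_congr (m := m) (t := t) hU] with x h1 h2 h3 h4 h5
    rw [h2, Pi.add_apply, h3, Pi.smul_apply, h4, h5, h1, smul_eq_mul]
  rw [Lp.ext_iff]
  exact ⟨fun h => Filter.EventuallyEq.trans h hR.symm, fun h => Filter.EventuallyEq.trans h hR⟩

theorem IsMildSolution.eq_duhamel {T M ε : ℝ} (hM : 0 ≤ M) {u : ℝ → IntegrableSpace n}
    {u₀ : EuclideanSpace ℝ (Fin n) → ℝ} (hu : IsMildSolution n m p u₀ ε T u)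
    (hb : ∀ t ∈ Ico 0 T, ∀ᵐ x ∂(volume : Measure (EuclideanSpace ℝ (Fin n))), |u t x| ≤ M)
    {U : IntegrableSpace n} (hU : U =ᵐ[volume] u₀) {t : ℝ} (ht : t ∈ Ico 0 T) :
    u t = ε • polyOp hm t U + duhamel hm (fun s => truncPowL1 hp hM (u s)) t :=
  (mild_formula_iff hm hp hM hu.1.1 hb hU ht).1 (hu.2 t ht)

/-- Both solutions share an essential bound, below which the power is Lipschitz on L¹. Grönwall's
inequality applies to the L¹ norm of the difference. -/
theorem IsMildSolution.eqOn (hm : 1 ≤ m) (hp : 1 < p) {T ε : ℝ} {u v : ℝ → IntegrableSpace n}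
    {u₀ : EuclideanSpace ℝ (Fin n) → ℝ} (hu₀ : Integrable u₀)
    (hu : IsMildSolution n m p u₀ ε T u) (hv : IsMildSolution n m p u₀ ε T v) :
    EqOn u v (Ico 0 T) := by
  obtain ⟨M₁, hM₁, hb₁⟩ := hu.1.exists_bound
  obtain ⟨M₂, hM₂, hb₂⟩ := hv.1.exists_bound
  have hM : 0 ≤ max M₁ M₂ := hM₁.trans (le_max_left _ _)
  intro t₁ ht₁
  have hU := Integrable.coeFn_toL1 hu₀
  have hequ := fun t ht => hu.eq_duhamel hm hp hM
    (fun t ht => (hb₁ t ht).mono fun x hx => hx.trans (le_max_left _ _)) hU (t := t) ht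
  have heqv := fun t ht => hv.eq_duhamel hm hp hM
    (fun t ht => (hb₂ t ht).mono fun x hx => hx.trans (le_max_right _ _)) hU (t := t) ht
  set u' := IccExtend ht₁.1 (domRestrict (Icc 0 t₁) u)
  set v' := IccExtend ht₁.1 (domRestrict (Icc 0 t₁) v)
  have hu' : Continuous u' := continuous_IccExtend_of_continuousOn hu.1.1 ht₁
  have hv' : Continuous v' := continuous_IccExtend_of_continuousOn hv.1.1 ht₁
  have huu : EqOn u' u (Icc 0 t₁) := IccExtend_domRestrict_eqOn ht₁.1 u
  have hvv : EqOn v' v (Icc 0 t₁) := IccExtend_domRestrict_eqOn ht₁.1 v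
  have hL : 0 ≤ p * (max M₁ M₂) ^ (p - 1) := mul_nonneg (by linarith) (Real.rpow_nonneg hM _)
  have hC : 0 ≤ ∫ z, |polyKernel n m 1 z| := integral_nonneg fun _ => abs_nonneg _
  have key : ∀ t ∈ Icc 0 t₁, ‖u' t - v' t‖ ≤
      (∫ z, |polyKernel n m 1 z|) * (p * (max M₁ M₂) ^ (p - 1)) *
        ∫ s in (0 : ℝ)..t, ‖u' s - v' s‖ := by
    intro t ht
    have ht' : t ∈ Ico 0 T := ⟨ht.1, ht.2.trans_lt ht₁.2⟩
    have hsub : ∀ s ∈ Icc 0 t, s ∈ Icc 0 t₁ := fun s hs => ⟨hs.1, hs.2.trans ht.2⟩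
    have h1 : duhamel hm (fun s => truncPowL1 hp hM (u s)) t =
        duhamel hm (fun s => truncPowL1 hp hM (u' s)) t :=
      duhamel_congr hm ht.1 fun s hs => by simp only [huu (hsub s hs)]
    have h2 : duhamel hm (fun s => truncPowL1 hp hM (v s)) t =
        duhamel hm (fun s => truncPowL1 hp hM (v' s)) t :=
      duhamel_congr hm ht.1 fun s hs => by simp only [hvv (hsub s hs)]
    have hcu := (continuous_truncPowL1 (n := n) hp hM).comp hu'
    have hcv := (continuous_truncPowL1 (n := n) hp hM).comp hv'
    rw [huu ht, hvv ht, hequ t ht', heqv t ht', add_sub_add_left_eq_sub, h1, h2]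
    refine (duhamel_sub hm hcu hcv t).symm ▸ ?_
    rw [mul_assoc, ← intervalIntegral.integral_const_mul]
    exact norm_duhamel_le hm ht.1 (fun s _ => norm_truncPowL1_sub_le hp hM _ _)
      ((((hu'.sub hv').norm).const_mul _).intervalIntegrable _ _)
  have := le_zero_of_le_mul_integral (hu'.sub hv').norm (mul_nonneg hC hL) key
    (t := t₁) ⟨ht₁.1, le_rfl⟩
  rw [← huu ⟨ht₁.1, le_rfl⟩, ← hvv ⟨ht₁.1, le_rfl⟩, ← sub_eq_zero]
  exact norm_le_zero_iff.1 this

theorem IsMildSolution.hasUniqueMildSolution (hm : 1 ≤ m) (hp : 1 < p) {T ε : ℝ}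
    {u : ℝ → IntegrableSpace n} {u₀ : EuclideanSpace ℝ (Fin n) → ℝ} (hu₀ : Integrable u₀)
    (hu : IsMildSolution n m p u₀ ε T u) : HasUniqueMildSolution n m p u₀ ε T :=
  ⟨u, hu, fun _ hv => hv.eqOn hm hp hu₀ hu⟩

end Mild

/-! ### Continuity in the supremum norm at positive times. -/

section Regularity

variable {n m : ℕ} (hm : 1 ≤ m)

/-- The kernel of the semigroup as an `L¹`-valued function of time, extended by zero to negative
times. -/
theorem exists_kernel_path (n : ℕ) {m : ℕ} (hm : 1 ≤ m) : ∃ k : ℝ → IntegrableSpace n,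
    AEStronglyMeasurable k volume ∧ (∀ t, ‖k t‖ ≤ ∫ z, |polyKernel n m 1 z|) ∧
    (∀ t, t ≠ 0 → ContinuousAt k t) ∧ (∀ t ≤ 0, k t = 0) ∧
    ∀ t > 0, ∀ f, polyOp hm t f = convL1 (k t) f := by
  obtain ⟨C, -, hC⟩ := polyKernel_decay n m hm (n + 1)
  have hK := polyKernel_integrable n m hm
  obtain ⟨k, hk, hkr⟩ := continuousOn_dilatedKernel hK (polyKernel_continuous n m hm) hC
  have hcont : ContinuousOn (fun t : ℝ => k (t ^ (1 / (2 * m : ℝ)))) (Ioi 0) :=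
    hk.comp (Real.continuous_rpow_const (by positivity)).continuousOn
      fun t ht => Real.rpow_pos_of_pos ht _
  refine ⟨(Ioi 0).indicator fun t => k (t ^ (1 / (2 * m : ℝ))), ?_, fun t => ?_, fun t ht => ?_,
    fun t ht => ?_, fun t ht f => ?_⟩
  · exact (aestronglyMeasurable_indicator_iff measurableSet_Ioi).2
      (hcont.aestronglyMeasurable measurableSet_Ioi)
  · by_cases ht : t ∈ Ioi 0
    · have hr : 0 < t ^ (1 / (2 * m : ℝ)) := Real.rpow_pos_of_pos ht _
      rw [indicator_of_mem ht, L1.norm_eq_integral_norm, ← integral_abs_dilatedKernel hr]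
      refine le_of_eq (integral_congr_ae ?_)
      filter_upwards [hkr _ hr] with x hx
      rw [hx, Real.norm_eq_abs]
    · rw [indicator_of_notMem ht, norm_zero]
      exact integral_nonneg fun _ => abs_nonneg _
  · rcases ht.lt_or_gt with h | h
    · refine (continuousAt_const (y := (0 : IntegrableSpace n))).congr ?_
      filter_upwards [Iio_mem_nhds h] with s hs
      rw [indicator_of_notMem (by simpa using le_of_lt hs)]
    · refine (hcont.continuousAt (Ioi_mem_nhds h)).congr ?_
      filter_upwards [Ioi_mem_nhds h] with s hs
      rw [indicator_of_mem hs]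
  · rw [indicator_of_notMem (by simpa using ht)]
  · have hr : 0 < t ^ (1 / (2 * m : ℝ)) := Real.rpow_pos_of_pos ht _
    rw [indicator_of_mem (show t ∈ Ioi 0 from ht)]
    exact dilatedConv_eq_convL1 hK hr (hkr _ hr) f

/-- Solutions of the linear problem with bounded data and forcing vary continuously, in the
supremum norm, at positive times. -/
theorem exists_modulus {T b A : ℝ} {F : ℝ → IntegrableSpace n}
    (hF : Continuous F) (hb : ∀ s, ∀ᵐ x ∂(volume : Measure (EuclideanSpace ℝ (Fin n))), |F s x| ≤ b)
    {U : IntegrableSpace n}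
    (hU : ∀ᵐ x ∂(volume : Measure (EuclideanSpace ℝ (Fin n))), |U x| ≤ A) {t₀ : ℝ}
    (ht₀ : t₀ ∈ Ioo 0 T) :
    ∃ ω : ℝ → ℝ, Filter.Tendsto ω (nhds t₀) (nhds 0) ∧ ∀ t ∈ Ioo 0 T,
      ∀ᵐ x ∂(volume : Measure (EuclideanSpace ℝ (Fin n))),
        |(polyOp hm t U + duhamel hm F t - (polyOp hm t₀ U + duhamel hm F t₀) :
          IntegrableSpace n) x| ≤ ω t := by
  obtain ⟨k, hkm, hkb, hkc, hk0, hkop⟩ := exists_kernel_path n hm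
  set C := ∫ z, |polyKernel n m 1 z|
  -- Because the kernel path is zero at nonpositive times, the Duhamel term becomes an integral over
  -- the fixed interval (0,T], with t only in the kernel.
  have hind : ∀ t s, convL1 (k (t - s)) (F s) =
      (Iio t).indicator (fun s => polyOp hm (t - s) (F s)) s := by
    intro t s
    by_cases hs : s < t
    · rw [indicator_of_mem (show s ∈ Iio t from hs), hkop _ (sub_pos.2 hs)]
    · rw [indicator_of_notMem (show s ∉ Iio t from hs), hk0 _ (by linarith), convL1_zero]
  have hint : ∀ t, IntegrableOn (fun s => convL1 (k (t - s)) (F s)) (Ioc 0 T) := by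
    intro t
    simp_rw [hind]
    exact (continuous_polyOp_comp_right hm hF t).integrableOn_Ioc.indicator measurableSet_Iio
  have hduh : ∀ t ∈ Ioo 0 T, duhamel hm F t = ∫ s in Ioc 0 T, convL1 (k (t - s)) (F s) := by
    intro t ht
    simp_rw [hind]
    rw [setIntegral_indicator measurableSet_Iio, duhamel, intervalIntegral.integral_of_le ht.1.le,
      integral_Ioc_eq_integral_Ioo]
    congr 2
    ext s
    simp only [mem_Ioo, mem_inter_iff, mem_Ioc, mem_Iio]
    exact ⟨fun h => ⟨⟨h.1, h.2.le.trans ht.2.le⟩, h.2⟩, fun h => ⟨h.1.1, h.2⟩⟩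
  have hmeas : ∀ t, AEStronglyMeasurable (fun s => k (t - s)) volume := fun t =>
    hkm.comp_quasiMeasurePreserving (quasiMeasurePreserving_sub_left volume t)
  have hbnd : ∀ t s, ‖‖k (t - s) - k (t₀ - s)‖‖ ≤ C + C := fun t s => by
    rw [norm_norm]
    exact (norm_sub_le _ _).trans (add_le_add (hkb _) (hkb _))
  have hmeas' : ∀ t, AEStronglyMeasurable (fun s => ‖k (t - s) - k (t₀ - s)‖)
      (volume.restrict (Ioc 0 T)) := fun t => ((hmeas t).sub (hmeas t₀)).norm.restrict
  have hconst : IntegrableOn (fun _ : ℝ => C + C) (Ioc 0 T) :=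
    integrableOn_const measure_Ioc_lt_top.ne
  -- Young's inequality for the linear term and under the Duhamel integral.
  refine ⟨fun t => ‖k t - k t₀‖ * A + ∫ s in Ioc 0 T, ‖k (t - s) - k (t₀ - s)‖ * b, ?_, ?_⟩
  · have h1 : Filter.Tendsto (fun t => ‖k t - k t₀‖ * A) (nhds t₀) (nhds 0) := by
      have := (tendsto_iff_norm_sub_tendsto_zero.1 (hkc t₀ ht₀.1.ne')).mul_const A
      rwa [zero_mul] at this
    have h2 : Filter.Tendsto (fun t => ∫ s in Ioc 0 T, ‖k (t - s) - k (t₀ - s)‖) (nhds t₀)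
        (nhds (∫ s in Ioc 0 T, (0 : ℝ))) := by
      refine tendsto_integral_filter_of_dominated_convergence (fun _ => C + C)
        (Filter.Eventually.of_forall hmeas')
        (Filter.Eventually.of_forall fun t => ae_of_all _ (hbnd t)) hconst ?_
      -- The kernel path need not be continuous at time 0, which is met only at s = t₀.
      have hne : ∀ᵐ s ∂(volume.restrict (Ioc 0 T)), s ≠ t₀ :=
        ae_restrict_of_ae (Measure.ae_ne volume t₀)
      filter_upwards [hne] with s hs
      refine tendsto_iff_norm_sub_tendsto_zero.1 ?_
      exact (hkc _ (sub_ne_zero.2 hs.symm)).tendsto.comp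
        (Continuous.tendsto (f := fun t : ℝ => t - s) (by fun_prop) t₀)
    simp_rw [integral_mul_const]
    rw [integral_zero] at h2
    have h3 := h1.add (h2.mul_const b)
    rwa [zero_mul, add_zero] at h3
  · intro t ht
    have hD : ∀ᵐ x ∂(volume : Measure (EuclideanSpace ℝ (Fin n))),
        |(duhamel hm F t - duhamel hm F t₀ : IntegrableSpace n) x| ≤
          ∫ s in Ioc 0 T, ‖k (t - s) - k (t₀ - s)‖ * b := by
      rw [hduh t ht, hduh t₀ ht₀, ← integral_sub (hint t) (hint t₀)]
      refine ae_abs_coe_integral_le ((hint t).sub (hint t₀)) ?_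
        (ae_of_all _ fun s => convL1_sub_ae_abs_le (hb s) _ _)
      exact (hconst.mono' (hmeas' t) (ae_of_all _ (hbnd t))).mul_const b
    have hS := convL1_sub_ae_abs_le hU (k t) (k t₀)
    rw [← hkop t ht.1, ← hkop t₀ ht₀.1] at hS
    rw [add_sub_add_comm]
    filter_upwards [hD, hS, Lp.coeFn_add (polyOp hm t U - polyOp hm t₀ U)
      (duhamel hm F t - duhamel hm F t₀)] with x h1 h2 h3
    rw [h3, Pi.add_apply]
    exact (abs_add_le _ _).trans (add_le_add h2 h1)

theorem memLp_top_of_ae_abs_le {f : IntegrableSpace n} {M : ℝ}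
    (hf : ∀ᵐ x ∂(volume : Measure (EuclideanSpace ℝ (Fin n))), |f x| ≤ M) : MemLp f ∞ volume :=
  memLp_top_of_bound (Lp.aestronglyMeasurable f) M hf

theorem norm_toLp_top_sub_le {f g : IntegrableSpace n} (hf : MemLp f ∞ volume)
    (hg : MemLp g ∞ volume) {M : ℝ} (hM : 0 ≤ M)
    (h : ∀ᵐ x ∂(volume : Measure (EuclideanSpace ℝ (Fin n))), |(f - g : IntegrableSpace n) x| ≤ M) :
    ‖hf.toLp f - hg.toLp g‖ ≤ M := by
  rw [← MemLp.toLp_sub, Lp.norm_toLp]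
  refine ENNReal.toReal_le_of_le_ofReal hM ?_
  rw [eLpNorm_exponent_top]
  refine eLpNormEssSup_le_of_ae_bound ?_
  filter_upwards [h, Lp.coeFn_sub f g] with x hx hs
  rwa [hs] at hx

/-- A bounded continuous solution of the Duhamel formula with bounded data and forcing belongs to
the solution class. -/
theorem inSolutionClass_of_duhamel {T M b A : ℝ} {u F : ℝ → IntegrableSpace n}
    (hM : 0 ≤ M) (hu : Continuous u)
    (hub : ∀ t ∈ Ico 0 T, ∀ᵐ x ∂(volume : Measure (EuclideanSpace ℝ (Fin n))), |u t x| ≤ M)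
    (hF : Continuous F) (hb : ∀ s, ∀ᵐ x ∂(volume : Measure (EuclideanSpace ℝ (Fin n))), |F s x| ≤ b)
    {U : IntegrableSpace n}
    (hU : ∀ᵐ x ∂(volume : Measure (EuclideanSpace ℝ (Fin n))), |U x| ≤ A)
    (heq : ∀ t ∈ Ico 0 T, u t = polyOp hm t U + duhamel hm F t) :
    InSolutionClass n T u := by
  classical
  let w : ℝ → Lp ℝ ∞ (volume : Measure (EuclideanSpace ℝ (Fin n))) := fun t =>
    if h : MemLp (u t) ∞ volume then h.toLp (u t) else 0
  have hmem : ∀ t ∈ Ico 0 T, MemLp (u t) ∞ volume := fun t ht => memLp_top_of_ae_abs_le (hub t ht)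
  have hw : ∀ t (ht : t ∈ Ico 0 T), w t = (hmem t ht).toLp (u t) := fun t ht => dif_pos (hmem t ht)
  -- L^∞ is not separable, so strong measurability is obtained from norm continuity on the open
  -- interval; the value of w elsewhere is irrelevant.
  have hcont : ContinuousOn w (Ioo 0 T) := by
    intro t₀ ht₀
    obtain ⟨ω, hω, hωb⟩ := exists_modulus hm hF hb hU ht₀
    refine ContinuousAt.continuousWithinAt ?_
    rw [ContinuousAt, tendsto_iff_norm_sub_tendsto_zero]
    have hω' : Filter.Tendsto (fun t => |ω t|) (nhds t₀) (nhds 0) := by simpa using hω.abs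
    refine squeeze_zero_norm' ?_ hω'
    filter_upwards [Ioo_mem_nhds ht₀.1 ht₀.2] with t ht
    rw [norm_norm, hw t (Ioo_subset_Ico_self ht), hw t₀ (Ioo_subset_Ico_self ht₀)]
    refine norm_toLp_top_sub_le _ _ (abs_nonneg _) ?_
    rw [heq t (Ioo_subset_Ico_self ht), heq t₀ (Ioo_subset_Ico_self ht₀)]
    filter_upwards [hωb t ht] with x hx
    exact hx.trans (le_abs_self _)
  refine ⟨hu.continuousOn, w, ?_, ?_⟩
  · refine memLp_top_of_bound (hcont.aestronglyMeasurable measurableSet_Ioo) M ?_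
    filter_upwards [ae_restrict_mem measurableSet_Ioo] with t ht
    rw [hw t (Ioo_subset_Ico_self ht), Lp.norm_toLp]
    refine ENNReal.toReal_le_of_le_ofReal hM ?_
    rw [eLpNorm_exponent_top]
    exact eLpNormEssSup_le_of_ae_bound (hub t (Ioo_subset_Ico_self ht))
  · filter_upwards [ae_restrict_mem measurableSet_Ioo] with t ht
    rw [hw t (Ioo_subset_Ico_self ht)]
    exact MemLp.coeFn_toLp _

end Regularity

/-! ### Decay estimates and the contraction argument. -/

section Existence

variable {n m : ℕ} (hm : 1 ≤ m)

theorem polyOp_ae_abs_le {f : IntegrableSpace n} {b : ℝ}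
    (hf : ∀ᵐ x ∂(volume : Measure (EuclideanSpace ℝ (Fin n))), |f x| ≤ b) (t : ℝ) :
    ∀ᵐ x ∂(volume : Measure (EuclideanSpace ℝ (Fin n))),
      |polyOp hm t f x| ≤ (∫ z, |polyKernel n m 1 z|) * b :=
  dilatedConv_ae_abs_le _ hf _

/-- The `L¹`–`L^∞` smoothing estimate. -/
theorem exists_polyOp_smoothing (n : ℕ) {m : ℕ} (hm : 1 ≤ m) : ∃ B : ℝ, 0 < B ∧ ∀ t > 0,
    ∀ f : IntegrableSpace n, ∀ᵐ x ∂(volume : Measure (EuclideanSpace ℝ (Fin n))),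
      |polyOp hm t f x| ≤ B * t ^ (-((n : ℝ) / (2 * m))) * ‖f‖ := by
  obtain ⟨B, hB0, hB⟩ := polyKernel_decay n m hm 0
  simp only [pow_zero, one_mul] at hB
  refine ⟨B, hB0, fun t ht f => ?_⟩
  have hr : 0 < t ^ (1 / (2 * m : ℝ)) := Real.rpow_pos_of_pos ht _
  have := dilatedConv_ae_abs_le_norm (polyKernel_integrable n m hm) hB hr f
  rw [← Real.rpow_natCast, ← Real.rpow_mul ht.le, ← Real.rpow_neg ht.le,
    one_div_mul_eq_div] at this
  exact this

/-- If 1+t ≤ 2(1+s), the decay of `f` at time s is already of the right order and L^∞ stability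
suffices. Otherwise t-s exceeds (1+t)/2 and smoothing from L¹ gives the decay. Each case loses a
factor 2^α, α = n/(2m). -/
theorem exists_polyOp_decay (n : ℕ) {m : ℕ} (hm : 1 ≤ m) : ∃ C : ℝ, 0 < C ∧
    ∀ {s t a b : ℝ}, 0 ≤ s → s ≤ t → 0 ≤ a → 0 ≤ b → ∀ f : IntegrableSpace n, ‖f‖ ≤ a →
      (∀ᵐ x ∂(volume : Measure (EuclideanSpace ℝ (Fin n))),
        |f x| ≤ b * (1 + s) ^ (-((n : ℝ) / (2 * m)))) →
      ∀ᵐ x ∂(volume : Measure (EuclideanSpace ℝ (Fin n))),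
        |polyOp hm (t - s) f x| ≤ C * (a + b) * (1 + t) ^ (-((n : ℝ) / (2 * m))) := by
  obtain ⟨B, hB0, hB⟩ := exists_polyOp_smoothing n hm
  set α := (n : ℝ) / (2 * m) with hα
  have hα0 : 0 ≤ α := by positivity
  set C₁ := ∫ z, |polyKernel n m 1 z|
  have hC₁ : 0 ≤ C₁ := integral_nonneg fun _ => abs_nonneg _
  have hhalf : ∀ {x y : ℝ}, 0 < x → x ≤ 2 * y → y ^ (-α) ≤ 2 ^ α * x ^ (-α) := by
    intro x y hx hxy
    have hy : x / 2 ≤ y := by linarith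
    calc y ^ (-α) ≤ (x / 2) ^ (-α) :=
          Real.rpow_le_rpow_of_nonpos (by positivity) hy (by linarith)
      _ = 2 ^ α * x ^ (-α) := by
          rw [Real.div_rpow hx.le (by norm_num), Real.rpow_neg (by norm_num : (0 : ℝ) ≤ 2)]
          field_simp
  refine ⟨2 ^ α * (C₁ + B), by positivity, fun {s t a b} hs hst ha hb f hfa hfb => ?_⟩
  have ht : 0 < 1 + t := by linarith
  have hpt := Real.rpow_pos_of_pos ht (-α)
  have h2 : (0 : ℝ) < 2 ^ α := by positivity
  by_cases hcase : 1 + t ≤ 2 * (1 + s)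
  · filter_upwards [polyOp_ae_abs_le hm hfb (t - s)] with x hx
    refine hx.trans ?_
    calc C₁ * (b * (1 + s) ^ (-α)) ≤ C₁ * (b * (2 ^ α * (1 + t) ^ (-α))) := by
          gcongr
          exact hhalf ht hcase
      _ = 2 ^ α * (C₁ * b) * (1 + t) ^ (-α) := by ring
      _ ≤ 2 ^ α * (C₁ + B) * (a + b) * (1 + t) ^ (-α) := by
          rw [mul_assoc (2 ^ α) (C₁ + B)]
          gcongr <;> linarith
  · push Not at hcase
    filter_upwards [hB (t - s) (by linarith) f] with x hx
    refine hx.trans ?_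
    calc B * (t - s) ^ (-α) * ‖f‖ ≤ B * (2 ^ α * (1 + t) ^ (-α)) * a := by
          gcongr
          exact hhalf ht (by linarith)
      _ = 2 ^ α * (B * a) * (1 + t) ^ (-α) := by ring
      _ ≤ 2 ^ α * (C₁ + B) * (a + b) * (1 + t) ^ (-α) := by
          rw [mul_assoc (2 ^ α) (C₁ + B)]
          gcongr <;> linarith

variable {p : ℝ} (hp : 1 < p)

theorem ae_abs_duhamel_le {F : ℝ → IntegrableSpace n} (hF : Continuous F) {t : ℝ} (ht : 0 ≤ t)
    {b : ℝ → ℝ} (hb : IntervalIntegrable b volume 0 t)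
    (h : ∀ s ∈ Icc 0 t, ∀ᵐ x ∂(volume : Measure (EuclideanSpace ℝ (Fin n))),
      |polyOp hm (t - s) (F s) x| ≤ b s) :
    ∀ᵐ x ∂(volume : Measure (EuclideanSpace ℝ (Fin n))),
      |duhamel hm F t x| ≤ ∫ s in (0 : ℝ)..t, b s := by
  rw [duhamel, intervalIntegral.integral_of_le ht, intervalIntegral.integral_of_le ht]
  refine ae_abs_coe_integral_le (continuous_polyOp_comp_right hm hF t).integrableOn_Ioc hb.1 ?_
  filter_upwards [ae_restrict_mem measurableSet_Ioc] with s hs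
  exact h s (Ioc_subset_Icc_self hs)

theorem continuousOn_one_add_rpow (q T : ℝ) :
    ContinuousOn (fun s : ℝ => (1 + s) ^ q) (Icc 0 T) := fun s hs =>
  ((continuousAt_const.add continuousAt_id).rpow_const
    (Or.inl (by have : (0 : ℝ) < 1 + s := by linarith [hs.1]
                exact this.ne'))).continuousWithinAt

theorem intervalIntegrable_one_add_rpow (q : ℝ) {T : ℝ} (hT : 0 ≤ T) :
    IntervalIntegrable (fun s : ℝ => (1 + s) ^ q) volume 0 T :=
  ContinuousOn.intervalIntegrable (by rw [uIcc_of_le hT]; exact continuousOn_one_add_rpow q T)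

theorem integral_one_add_rpow_mono (q : ℝ) {t T : ℝ} (ht : 0 ≤ t) (htT : t ≤ T) :
    ∫ s in (0 : ℝ)..t, (1 + s) ^ q ≤ ∫ s in (0 : ℝ)..T, (1 + s) ^ q := by
  refine intervalIntegral.integral_mono_interval le_rfl ht htT ?_
    (intervalIntegrable_one_add_rpow q (ht.trans htT))
  filter_upwards [ae_restrict_mem measurableSet_Ioc] with s hs
  exact Real.rpow_nonneg (by linarith [hs.1]) _

/-- The Banach fixed point argument in the ball of functions decaying like the linear flow. -/
theorem exists_fixedPoint (n : ℕ) {m : ℕ} (hm : 1 ≤ m) : ∃ C : ℝ, 0 < C ∧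
    ∀ {ε A M T : ℝ} (hM : 0 ≤ M) (U : IntegrableSpace n), 0 < ε → 0 ≤ A → 0 < T →
      (∀ᵐ x ∂(volume : Measure (EuclideanSpace ℝ (Fin n))), |U x| ≤ A) →
      2 * C * ε * (‖U‖ + A) ≤ M →
      2 * C * (p + 1) * M ^ (p - 1) *
        ∫ s in (0 : ℝ)..T, (1 + s) ^ (-((n : ℝ) / (2 * m) * (p - 1))) ≤ 1 →
      ∃ u : ℝ → IntegrableSpace n, Continuous u ∧
        (∀ t, ∀ᵐ x ∂(volume : Measure (EuclideanSpace ℝ (Fin n))), |u t x| ≤ M) ∧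
        ∀ t ∈ Icc 0 T, u t = ε • polyOp hm t U +
          duhamel hm (fun s => truncPowL1 hp hM (u s)) t := by
  obtain ⟨C₂, hC₂, hdecay⟩ := exists_polyOp_decay n hm
  set α := (n : ℝ) / (2 * m) with hα
  set C₁ := ∫ z, |polyKernel n m 1 z|
  have hα0 : 0 ≤ α := by positivity
  have hC₁ : 0 ≤ C₁ := integral_nonneg fun _ => abs_nonneg _
  -- C₁ serves the L¹ norm and C₂ the decaying supremum bound.
  refine ⟨C₁ + C₂, by positivity, fun {ε A M T} hM U hε hA hT hU hlin hnl => ?_⟩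
  set Φ := ∫ s in (0 : ℝ)..T, (1 + s) ^ (-(α * (p - 1)))
  have hΦ : 0 ≤ Φ := intervalIntegral.integral_nonneg hT.le fun s hs =>
    Real.rpow_nonneg (by linarith [hs.1]) _
  have hMp : 0 ≤ M ^ (p - 1) := Real.rpow_nonneg hM _
  have hMpow : M ^ p = M ^ (p - 1) * M := by
    rcases hM.eq_or_lt with h | h
    · rw [← h, Real.zero_rpow (by linarith), mul_zero]
    · rw [← Real.rpow_add_one h.ne', sub_add_cancel]
  -- the invariant ball
  let Z : Set C(Icc (0 : ℝ) T, IntegrableSpace n) := {u | ∀ t, ‖u t‖ ≤ M ∧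
    ∀ᵐ x ∂(volume : Measure (EuclideanSpace ℝ (Fin n))), |u t x| ≤ M * (1 + (t : ℝ)) ^ (-α)}
  have hZ : IsClosed Z := by
    have : Z = ⋂ t, {u : C(Icc (0 : ℝ) T, IntegrableSpace n) | ‖u t‖ ≤ M} ∩
        (fun u : C(Icc (0 : ℝ) T, IntegrableSpace n) => u t) ⁻¹'
          {f | ∀ᵐ x ∂volume, |f x| ≤ M * (1 + (t : ℝ)) ^ (-α)} := by
      ext u
      simp [Z]
    rw [this]
    refine isClosed_iInter fun t => IsClosed.inter ?_ ?_
    · exact isClosed_le (continuous_eval_const t).norm continuous_const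
    · exact (isClosed_ae_abs_le _).preimage (continuous_eval_const t)
  have hext : ∀ (u : C(Icc (0 : ℝ) T, IntegrableSpace n)), Continuous (IccExtend hT.le u) :=
    fun u => u.continuous.Icc_extend'
  have hcN : ∀ (u : C(Icc (0 : ℝ) T, IntegrableSpace n)),
      Continuous fun s => truncPowL1 hp hM (IccExtend hT.le u s) := fun u =>
    (continuous_truncPowL1 hp hM).comp (hext u)
  have hcS : Continuous fun t => ε • polyOp hm t U :=
    ((continuous_polyOp hm).comp (f := fun t : ℝ => (t, U)) (by fun_prop)).const_smul ε
  let Ψ : C(Icc (0 : ℝ) T, IntegrableSpace n) → C(Icc (0 : ℝ) T, IntegrableSpace n) := fun u =>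
    ⟨fun t => ε • polyOp hm t U + duhamel hm (fun s => truncPowL1 hp hM (IccExtend hT.le u s)) t,
      (hcS.add (continuous_duhamel hm (hcN u))).comp continuous_subtype_val⟩
  have hdec1 : ∀ s : ℝ, 0 ≤ s → M * (1 + s) ^ (-α) ≤ M := fun s hs =>
    mul_le_of_le_one_right hM (Real.rpow_le_one_of_one_le_of_nonpos (by linarith) (by linarith))
  have hdec0 : ∀ s : ℝ, 0 ≤ s → 0 ≤ M * (1 + s) ^ (-α) := fun s hs =>
    mul_nonneg hM (Real.rpow_nonneg (by linarith) _)
  have hpw : ∀ s : ℝ, 0 ≤ s →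
      (M * (1 + s) ^ (-α)) ^ (p - 1) = M ^ (p - 1) * (1 + s) ^ (-(α * (p - 1))) := fun s hs => by
    rw [Real.mul_rpow hM (Real.rpow_nonneg (by linarith) _), ← Real.rpow_mul (by linarith), neg_mul]
  have hZb : ∀ u ∈ Z, ∀ s (hs : s ∈ Icc 0 T), ‖IccExtend hT.le u s‖ ≤ M ∧
      ∀ᵐ x ∂(volume : Measure (EuclideanSpace ℝ (Fin n))),
        |IccExtend hT.le u s x| ≤ M * (1 + s) ^ (-α) := by
    intro u hu s hs
    rw [IccExtend_of_mem _ _ hs]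
    exact hu ⟨s, hs⟩
  have hNnorm : ∀ u ∈ Z, ∀ s ∈ Icc 0 T, ‖truncPowL1 hp hM (IccExtend hT.le u s)‖ ≤
      p * M ^ p * (1 + s) ^ (-(α * (p - 1))) := by
    intro u hu s hs
    obtain ⟨h1, h2⟩ := hZb u hu s hs
    rw [truncPowL1_eq hp (hdec0 s hs.1) hM (hdec1 s hs.1) h2]
    refine (norm_truncPowL1_le hp (hdec0 s hs.1) _).trans ?_
    rw [hpw s hs.1, hMpow]
    have := Real.rpow_nonneg (by linarith [hs.1] : 0 ≤ 1 + s) (-(α * (p - 1)))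
    calc p * (M ^ (p - 1) * (1 + s) ^ (-(α * (p - 1)))) * ‖IccExtend hT.le u s‖ ≤
          p * (M ^ (p - 1) * (1 + s) ^ (-(α * (p - 1)))) * M := by gcongr
      _ = _ := by ring
  have hNsup : ∀ u ∈ Z, ∀ s ∈ Icc 0 T, ∀ᵐ x ∂(volume : Measure (EuclideanSpace ℝ (Fin n))),
      |truncPowL1 hp hM (IccExtend hT.le u s) x| ≤
        M ^ p * (1 + s) ^ (-(α * (p - 1))) * (1 + s) ^ (-α) := by
    intro u hu s hs
    obtain ⟨h1, h2⟩ := hZb u hu s hs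
    rw [truncPowL1_eq hp (hdec0 s hs.1) hM (hdec1 s hs.1) h2]
    filter_upwards [truncPowL1_ae_abs_le hp (hdec0 s hs.1) (IccExtend hT.le u s)] with x hx
    refine hx.trans (le_of_eq ?_)
    rw [mul_assoc, ← Real.rpow_add (by linarith [hs.1]), Real.mul_rpow hM
      (Real.rpow_nonneg (by linarith [hs.1]) _), ← Real.rpow_mul (by linarith [hs.1])]
    congr 2
    ring
  have hmaps : MapsTo Ψ Z Z := by
    intro u hu t
    have ht0 := t.2.1
    have hsub : ∀ s ∈ Icc 0 (t : ℝ), s ∈ Icc 0 T := fun s hs => ⟨hs.1, hs.2.trans t.2.2⟩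
    have hmono := integral_one_add_rpow_mono (-(α * (p - 1))) ht0 t.2.2
    have hint := intervalIntegrable_one_add_rpow (-(α * (p - 1))) ht0
    -- The linear and the Duhamel term each take half of M. In the factor p+1, the p comes from the
    -- L¹ estimate of the truncated power and the 1 from its supremum bound.
    have hnl' : (C₁ + C₂) * (p + 1) * M ^ p * Φ ≤ M / 2 := by
      rw [hMpow]
      nlinarith [mul_le_mul_of_nonneg_right hnl hM]
    constructor
    · have h1 : ‖ε • polyOp hm t U‖ ≤ ε * (C₁ * ‖U‖) := by
        rw [norm_smul, Real.norm_of_nonneg hε.le]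
        exact mul_le_mul_of_nonneg_left (norm_polyOp_le hm _ _) hε.le
      have h2 : ‖duhamel hm (fun s => truncPowL1 hp hM (IccExtend hT.le u s)) t‖ ≤
          C₁ * (p * M ^ p * Φ) := by
        refine (norm_duhamel_le hm ht0 (fun s hs => hNnorm u hu s (hsub s hs))
          (hint.const_mul _)).trans ?_
        rw [intervalIntegral.integral_const_mul]
        gcongr
      have h3 : ε * (C₁ * ‖U‖) ≤ M / 2 := by
        have : ε * (C₁ * ‖U‖) ≤ (C₁ + C₂) * ε * (‖U‖ + A) := by
          nlinarith [mul_nonneg (mul_nonneg hC₁ hε.le) hA, mul_nonneg (mul_nonneg hC₂.le hε.le) hA,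
            mul_nonneg (mul_nonneg hC₂.le hε.le) (norm_nonneg U)]
        linarith
      have h4 : C₁ * (p * M ^ p * Φ) ≤ (C₁ + C₂) * (p + 1) * M ^ p * Φ := by
        have : C₁ * p ≤ (C₁ + C₂) * (p + 1) := by nlinarith
        calc C₁ * (p * M ^ p * Φ) = C₁ * p * (M ^ p * Φ) := by ring
          _ ≤ (C₁ + C₂) * (p + 1) * (M ^ p * Φ) := by gcongr
          _ = _ := by ring
      exact (norm_add_le _ _).trans (by linarith)
    · have hd := hdecay (s := 0) (t := t) (b := A) le_rfl ht0 (norm_nonneg U) hA U le_rfl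
        (by simpa using hU)
      rw [sub_zero] at hd
      have hpt : 0 ≤ (1 + (t : ℝ)) ^ (-α) := Real.rpow_nonneg (by linarith) _
      have hN := ae_abs_duhamel_le hm (hcN u) ht0
        (b := fun s => C₂ * (p * M ^ p + M ^ p) * (1 + (t : ℝ)) ^ (-α) *
          (1 + s) ^ (-(α * (p - 1)))) (hint.const_mul _) (fun s hs => by
          have hrp := Real.rpow_nonneg (by linarith [hs.1] : 0 ≤ 1 + s) (-(α * (p - 1)))
          have := hdecay (s := s) (t := t) (a := p * M ^ p * (1 + s) ^ (-(α * (p - 1))))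
            (b := M ^ p * (1 + s) ^ (-(α * (p - 1)))) hs.1 hs.2 (by positivity) (by positivity)
            _ (hNnorm u hu s (hsub s hs)) (hNsup u hu s (hsub s hs))
          filter_upwards [this] with x hx
          refine hx.trans (le_of_eq (by ring)))
      rw [intervalIntegral.integral_const_mul] at hN
      filter_upwards [hd, hN, Lp.coeFn_add (ε • polyOp hm t U)
        (duhamel hm (fun s => truncPowL1 hp hM (IccExtend hT.le u s)) t),
        Lp.coeFn_smul ε (polyOp hm t U)] with x h1 h2 h3 h4
      change |(ε • polyOp hm t U + duhamel hm (fun s => truncPowL1 hp hM (IccExtend hT.le u s)) t :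
        IntegrableSpace n) x| ≤ _
      rw [h3, Pi.add_apply, h4, Pi.smul_apply, smul_eq_mul]
      refine (abs_add_le _ _).trans ?_
      rw [abs_mul, abs_of_pos hε]
      have h5 : ε * |polyOp hm t U x| ≤ M / 2 * (1 + (t : ℝ)) ^ (-α) := by
        calc ε * |polyOp hm t U x| ≤ ε * (C₂ * (‖U‖ + A) * (1 + (t : ℝ)) ^ (-α)) := by gcongr
          _ = (C₂ * ε * (‖U‖ + A)) * (1 + (t : ℝ)) ^ (-α) := by ring
          _ ≤ M / 2 * (1 + (t : ℝ)) ^ (-α) := by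
            gcongr
            have : 0 ≤ C₁ * ε * (‖U‖ + A) := by positivity
            linarith
      have h6 : C₂ * (p * M ^ p + M ^ p) * (1 + (t : ℝ)) ^ (-α) *
          ∫ s in (0 : ℝ)..t, (1 + s) ^ (-(α * (p - 1))) ≤ M / 2 * (1 + (t : ℝ)) ^ (-α) := by
        calc _ ≤ C₂ * (p * M ^ p + M ^ p) * (1 + (t : ℝ)) ^ (-α) * Φ := by gcongr
          _ = (C₂ * (p + 1) * M ^ p * Φ) * (1 + (t : ℝ)) ^ (-α) := by ring
          _ ≤ M / 2 * (1 + (t : ℝ)) ^ (-α) := by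
            gcongr
            have : 0 ≤ C₁ * (p + 1) * M ^ p * Φ := by positivity
            linarith
      linarith
  -- Contraction is needed only in the uniform-in-time L¹ distance, since the ball with its supremum
  -- bounds is closed for it.
  have hcontr : ContractingWith (1 / 2) (hmaps.restrict Ψ Z Z) := by
    refine ⟨by rw [← NNReal.coe_lt_coe]; norm_num, LipschitzWith.of_dist_le_mul ?_⟩
    rintro ⟨u, hu⟩ ⟨v, hv⟩
    rw [Subtype.dist_eq, Subtype.dist_eq, MapsTo.val_restrict_apply, MapsTo.val_restrict_apply]
    refine (ContinuousMap.dist_le (by positivity)).2 fun t => ?_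
    have ht0 := t.2.1
    have hsub : ∀ s ∈ Icc 0 (t : ℝ), s ∈ Icc 0 T := fun s hs => ⟨hs.1, hs.2.trans t.2.2⟩
    have hmono := integral_one_add_rpow_mono (-(α * (p - 1))) ht0 t.2.2
    have hint := intervalIntegrable_one_add_rpow (-(α * (p - 1))) ht0
    change dist (ε • polyOp hm t U + duhamel hm (fun s => truncPowL1 hp hM (IccExtend hT.le u s)) t)
      (ε • polyOp hm t U + duhamel hm (fun s => truncPowL1 hp hM (IccExtend hT.le v s)) t) ≤ _
    rw [dist_add_left, dist_eq_norm, duhamel_sub hm (hcN u) (hcN v)]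
    refine (norm_duhamel_le hm ht0 (b := fun s => p * M ^ (p - 1) * dist u v *
      (1 + s) ^ (-(α * (p - 1)))) (fun s hs => ?_) (hint.const_mul _)).trans ?_
    · have hsT := hsub s hs
      have h1 := (hZb u hu s hsT).2
      have h2 := (hZb v hv s hsT).2
      rw [truncPowL1_eq hp (hdec0 s hs.1) hM (hdec1 s hs.1) h1,
        truncPowL1_eq hp (hdec0 s hs.1) hM (hdec1 s hs.1) h2]
      refine (norm_truncPowL1_sub_le hp (hdec0 s hs.1) _ _).trans ?_
      have h3 : ‖IccExtend hT.le u s - IccExtend hT.le v s‖ ≤ dist u v := by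
        rw [IccExtend_of_mem _ _ hsT, IccExtend_of_mem _ _ hsT, ← dist_eq_norm]
        exact ContinuousMap.dist_apply_le_dist _
      rw [hpw s hs.1]
      have := Real.rpow_nonneg (by linarith [hs.1] : 0 ≤ 1 + s) (-(α * (p - 1)))
      calc p * (M ^ (p - 1) * (1 + s) ^ (-(α * (p - 1)))) * _ ≤
            p * (M ^ (p - 1) * (1 + s) ^ (-(α * (p - 1)))) * dist u v := by gcongr
        _ = _ := by ring
    · rw [intervalIntegral.integral_const_mul]
      have h4 : C₁ * (p * M ^ (p - 1) * Φ) ≤ 1 / 2 := by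
        have : C₁ * p ≤ (C₁ + C₂) * (p + 1) := by nlinarith
        have h5 : C₁ * p * (M ^ (p - 1) * Φ) ≤ (C₁ + C₂) * (p + 1) * (M ^ (p - 1) * Φ) := by gcongr
        nlinarith
      calc C₁ * (p * M ^ (p - 1) * dist u v * ∫ s in (0 : ℝ)..t, (1 + s) ^ (-(α * (p - 1)))) ≤
            C₁ * (p * M ^ (p - 1) * dist u v * Φ) := by gcongr
        _ = C₁ * (p * M ^ (p - 1) * Φ) * dist u v := by ring
        _ ≤ 1 / 2 * dist u v := by gcongr
        _ = _ := by norm_num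
  have hzero : (0 : C(Icc (0 : ℝ) T, IntegrableSpace n)) ∈ Z := by
    intro t
    refine ⟨by simpa using hM, ?_⟩
    filter_upwards [Lp.coeFn_zero ℝ 1 (volume : Measure (EuclideanSpace ℝ (Fin n)))] with x hx
    rw [ContinuousMap.zero_apply, hx, Pi.zero_apply, abs_zero]
    exact hdec0 t t.2.1
  obtain ⟨u, huZ, hfix, -⟩ := hcontr.exists_fixedPoint' hZ.isComplete hmaps hzero
    (edist_ne_top _ _)
  have hfix' : Ψ u = u := hfix
  refine ⟨IccExtend hT.le u, hext u, fun t => ?_, fun t ht => ?_⟩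
  · have h := (huZ (projIcc 0 T hT.le t)).2
    filter_upwards [h] with x hx
    exact hx.trans (hdec1 _ (projIcc 0 T hT.le t).2.1)
  · rw [IccExtend_of_mem _ _ ht]
    conv_lhs => rw [← hfix']
    rfl

end Existence

/-- Existence of a mild solution under a smallness condition that relates the size of the data and
the length of the time interval. -/
theorem exists_isMildSolution (n : ℕ) {m : ℕ} (hm : 1 ≤ m) {p : ℝ} (hp : 1 < p)
    {u₀ : EuclideanSpace ℝ (Fin n) → ℝ} (hu₀ : Integrable u₀) (hu₀' : MemLp u₀ ∞ volume) :
    ∃ κ : ℝ, 0 < κ ∧ ∀ ε T : ℝ, 0 < ε → 0 < T →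
      ε ^ (p - 1) * ∫ s in (0 : ℝ)..T, (1 + s) ^ (-((n : ℝ) / (2 * m) * (p - 1))) ≤ κ →
      ∃ u, IsMildSolution n m p u₀ ε T u := by
  obtain ⟨C, hC, hfix⟩ := exists_fixedPoint hp n hm
  set U := hu₀.toL1 u₀
  have hU : U =ᵐ[volume] u₀ := Integrable.coeFn_toL1 hu₀
  set A := (eLpNorm u₀ ∞ volume).toReal
  have hA : 0 ≤ A := ENNReal.toReal_nonneg
  have hUA : ∀ᵐ x ∂(volume : Measure (EuclideanSpace ℝ (Fin n))), |U x| ≤ A := by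
    have h3 := ae_le_eLpNormEssSup (f := u₀) (μ := volume)
    filter_upwards [h3, hU] with x hx hUx
    rw [← eLpNorm_exponent_top] at hx
    rw [hUx]
    have := ENNReal.toReal_mono hu₀'.2.ne hx
    rwa [toReal_enorm, Real.norm_eq_abs] at this
  set D := ‖U‖ + A + 1
  have hD : 0 < D := by positivity
  -- With M = 2CDε the smallness condition of the fixed point is κ₁ ε^{p-1} ∫ ≤ 1. The summand 1 in
  -- D keeps it positive for zero data.
  set κ₁ := 2 * C * (p + 1) * (2 * C * D) ^ (p - 1)
  have hκ : 0 < κ₁ := by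
    have := Real.rpow_pos_of_pos (show 0 < 2 * C * D by positivity) (p - 1)
    have : 0 < p + 1 := by linarith
    positivity
  refine ⟨κ₁⁻¹, inv_pos.2 hκ, fun ε T hε hT hsmall => ?_⟩
  have hM : 0 ≤ 2 * C * D * ε := by positivity
  obtain ⟨u, huc, hub, hueq⟩ := hfix hM U hε hA hT hUA
    (by
      have : 0 ≤ 2 * C * ε := by positivity
      nlinarith)
    (by
      rw [Real.mul_rpow (by positivity) hε.le]
      have := mul_le_mul_of_nonneg_left hsmall hκ.le
      rw [mul_inv_cancel₀ hκ.ne'] at this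
      refine le_trans (le_of_eq ?_) this
      ring)
  have hcF : Continuous fun s => truncPowL1 hp hM (u s) := (continuous_truncPowL1 hp hM).comp huc
  have hεU : ∀ᵐ x ∂(volume : Measure (EuclideanSpace ℝ (Fin n))),
      |(ε • U : IntegrableSpace n) x| ≤ ε * A := by
    filter_upwards [hUA, Lp.coeFn_smul ε U] with x hx hs
    rw [hs, Pi.smul_apply, smul_eq_mul, abs_mul, abs_of_pos hε]
    gcongr
  have hclass : InSolutionClass n T u :=
    inSolutionClass_of_duhamel hm hM huc (fun t _ => hub t) hcF
      (fun s => truncPowL1_ae_abs_le hp hM (u s)) hεU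
      (fun t ht => by rw [map_smul]; exact hueq t (Ico_subset_Icc_self ht))
  exact ⟨u, hclass, fun t ht => (mild_formula_iff hm hp hM hclass.1 (fun t _ => hub t) hU ht).2
    (hueq t (Ico_subset_Icc_self ht))⟩

/-! ### Slowly varying weights and the semigroup. -/

section Weight

variable {n : ℕ}

/-- The weight `(1 + |x| / R)^(-n-1)`. -/
noncomputable def polyWeight (n : ℕ) (R : ℝ) (x : EuclideanSpace ℝ (Fin n)) : ℝ :=
  ((1 + ‖x‖ / R) ^ (n + 1))⁻¹

variable {R : ℝ}

theorem polyWeight_pos (hR : 0 < R) (x : EuclideanSpace ℝ (Fin n)) : 0 < polyWeight n R x := by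
  unfold polyWeight
  positivity

theorem polyWeight_le_one (hR : 0 < R) (x : EuclideanSpace ℝ (Fin n)) : polyWeight n R x ≤ 1 := by
  refine inv_le_one_of_one_le₀ (one_le_pow₀ ?_)
  have : 0 ≤ ‖x‖ / R := by positivity
  linarith

theorem abs_polyWeight_le_one (hR : 0 < R) (x : EuclideanSpace ℝ (Fin n)) :
    |polyWeight n R x| ≤ 1 := by
  rw [abs_of_pos (polyWeight_pos hR x)]
  exact polyWeight_le_one hR x

theorem polyWeight_mono {R' : ℝ} (hR : 0 < R) (h : R ≤ R') (x : EuclideanSpace ℝ (Fin n)) :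
    polyWeight n R x ≤ polyWeight n R' x := by
  unfold polyWeight
  have : 0 < R' := hR.trans_le h
  gcongr

theorem continuous_polyWeight (hR : 0 < R) : Continuous (polyWeight n R) := by
  unfold polyWeight
  refine Continuous.inv₀ (by fun_prop) fun x => ?_
  positivity

theorem memLp_top_polyWeight (hR : 0 < R) : MemLp (polyWeight n R) ∞ volume :=
  memLp_top_of_bound (continuous_polyWeight hR).aestronglyMeasurable 1
    (ae_of_all _ (abs_polyWeight_le_one hR))

theorem integrable_polyWeight (hR : 0 < R) : Integrable (polyWeight n R) := by
  have h := (integrable_comp_smul_iff volume (fun x : EuclideanSpace ℝ (Fin n) =>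
    (1 + ‖x‖) ^ (-((n : ℝ) + 1))) (inv_ne_zero hR.ne')).2
    (integrable_one_add_norm (by rw [finrank_euclideanSpace_fin]; linarith))
  refine h.congr (ae_of_all _ fun x => ?_)
  simp only
  rw [norm_smul, Real.norm_of_nonneg (by positivity), polyWeight, Real.rpow_neg (by positivity),
    div_eq_inv_mul]
  norm_cast

theorem integral_polyWeight_pos (hR : 0 < R) : 0 < ∫ x, polyWeight n R x := by
  rw [integral_pos_iff_support_of_nonneg (fun x => (polyWeight_pos hR x).le)
    (integrable_polyWeight hR)]
  have : Function.support (polyWeight n R) = univ := by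
    ext x
    simp [(polyWeight_pos hR x).ne']
  rw [this]
  exact Measure.measure_univ_pos.2 (NeZero.ne _)

theorem integral_polyWeight (hR : 0 < R) :
    ∫ x, polyWeight n R x = R ^ n * ∫ x, polyWeight n 1 x := by
  have := Measure.integral_comp_smul (volume : Measure (EuclideanSpace ℝ (Fin n)))
    (polyWeight n 1) R⁻¹
  rw [finrank_euclideanSpace_fin, abs_of_pos (by positivity), smul_eq_mul, inv_pow, inv_inv] at this
  rw [← this]
  congr 1
  ext x
  rw [polyWeight, polyWeight, norm_smul, Real.norm_of_nonneg (by positivity), div_one,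
    div_eq_inv_mul]

/-- Since a, b ≥ 1, an additive error δ is a multiplicative one: a ≤ (1+δ)b and b ≤ (1+δ)a. -/
theorem abs_inv_pow_sub_inv_pow_le {a b δ : ℝ} (ha : 1 ≤ a) (hb : 1 ≤ b) (hab : |b - a| ≤ δ)
    (N : ℕ) : |(b ^ N)⁻¹ - (a ^ N)⁻¹| ≤ ((1 + δ) ^ N - 1) * (a ^ N)⁻¹ := by
  have hδ : 0 ≤ δ := (abs_nonneg _).trans hab
  obtain ⟨h1, h2⟩ := abs_le.1 hab
  have haN : 0 < a ^ N := by positivity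
  have hbN : 0 < b ^ N := by positivity
  have hX : 1 ≤ (1 + δ) ^ N := one_le_pow₀ (by linarith)
  have h3 : a ^ N ≤ (1 + δ) ^ N * b ^ N := by
    rw [← mul_pow]
    exact pow_le_pow_left₀ (by linarith) (by nlinarith) N
  have h4 : b ^ N ≤ (1 + δ) ^ N * a ^ N := by
    rw [← mul_pow]
    exact pow_le_pow_left₀ (by linarith) (by nlinarith) N
  have h5 : (b ^ N)⁻¹ - (a ^ N)⁻¹ = (a ^ N - b ^ N) / b ^ N * (a ^ N)⁻¹ := by
    field_simp
  rw [h5, abs_mul, abs_of_pos (inv_pos.2 haN), abs_div, abs_of_pos hbN]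
  refine mul_le_mul_of_nonneg_right ?_ (inv_pos.2 haN).le
  rw [div_le_iff₀ hbN, abs_le]
  constructor <;> nlinarith

/-- Convexity of (1+d)^N along the chord from 0; it extracts the small factor l = 1/L. -/
theorem one_add_mul_pow_sub_one_le {l d : ℝ} (hl : 0 ≤ l) (hl1 : l ≤ 1) (hd : 0 ≤ d) (N : ℕ) :
    (1 + l * d) ^ N - 1 ≤ l * ((1 + d) ^ N - 1) := by
  induction N with
  | zero => simp
  | succ N ih =>
    have hX : 1 ≤ (1 + d) ^ N := one_le_pow₀ (by linarith)
    have hld : 0 ≤ l * d := mul_nonneg hl hd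
    rw [pow_succ, pow_succ]
    have h1 : (1 + l * d) ^ N * (1 + l * d) ≤ (1 + l * ((1 + d) ^ N - 1)) * (1 + l * d) := by
      gcongr
      linarith
    have h2 : l * l * (((1 + d) ^ N - 1) * d) ≤ l * (((1 + d) ^ N - 1) * d) := by
      have : 0 ≤ ((1 + d) ^ N - 1) * d := mul_nonneg (by linarith) hd
      gcongr
      nlinarith
    nlinarith

/-- The weight varies slowly on the scale `R`. -/
theorem abs_polyWeight_add_sub_le {L : ℝ} (hL : 1 ≤ L) (hR : 0 < R)
    {h z x : EuclideanSpace ℝ (Fin n)} (hh : ‖h‖ ≤ R / L * ‖z‖) :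
    |polyWeight n R (x + h) - polyWeight n R x| ≤
      1 / L * (1 + ‖z‖) ^ (n + 1) * polyWeight n R x := by
  have hL0 : 0 < L := by linarith
  have h1 : |(1 + ‖x + h‖ / R) - (1 + ‖x‖ / R)| ≤ 1 / L * ‖z‖ := by
    rw [add_sub_add_left_eq_sub, ← sub_div, abs_div, abs_of_pos hR, div_le_iff₀ hR]
    have := abs_norm_sub_norm_le (x + h) x
    rw [add_sub_cancel_left] at this
    refine (this.trans hh).trans (le_of_eq ?_)
    ring
  have hx : 0 ≤ ‖x‖ / R := by positivity
  have hxh : 0 ≤ ‖x + h‖ / R := by positivity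
  refine (abs_inv_pow_sub_inv_pow_le (by linarith) (by linarith) h1 (n + 1)).trans ?_
  refine mul_le_mul_of_nonneg_right ?_ (polyWeight_pos hR x).le
  have h2 := one_add_mul_pow_sub_one_le (l := 1 / L) (by positivity)
    (by rw [div_le_one hL0]; exact hL) (norm_nonneg z) (n + 1)
  refine h2.trans ?_
  gcongr
  linarith

theorem integrable_one_add_norm_pow_mul_polyKernel (n : ℕ) {m : ℕ} (hm : 1 ≤ m) :
    Integrable fun z : EuclideanSpace ℝ (Fin n) => (1 + ‖z‖) ^ (n + 1) * |polyKernel n m 1 z| := by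
  -- One power n+1 pays for the moment, the other for integrability.
  obtain ⟨C, hC, hdec⟩ := polyKernel_decay n m hm ((n + 1) + (n + 1))
  refine ((integrable_polyWeight (n := n) one_pos).const_mul C).mono' ?_ (ae_of_all _ fun z => ?_)
  · have := polyKernel_continuous n m hm
    exact (by fun_prop : Continuous _).aestronglyMeasurable
  · rw [Real.norm_of_nonneg (by positivity), polyWeight, div_one, ← div_eq_mul_inv,
      le_div_iff₀ (by positivity)]
    refine le_trans (le_of_eq ?_) (hdec z)
    rw [pow_add]
    ring

/-- The semigroup almost preserves integrals against slowly varying weights. -/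
theorem weightedIntegral_polyOp_ge {m : ℕ} (hm : 1 ≤ m) {L t : ℝ} (hL : 1 ≤ L) (ht : 0 ≤ t)
    (hR : 0 < R) (htR : L * t ^ (1 / (2 * m : ℝ)) ≤ R) (f : IntegrableSpace n) :
    (∫ x, polyWeight n R x * f x) -
      (∫ z : EuclideanSpace ℝ (Fin n), (1 + ‖z‖) ^ (n + 1) * |polyKernel n m 1 z|) / L *
        ∫ x, polyWeight n R x * |f x| ≤
      weightedIntegral (polyWeight n R) (memLp_top_polyWeight hR) (polyOp hm t f) := by
  have hL0 : 0 < L := by linarith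
  set r := t ^ (1 / (2 * m : ℝ))
  have hr : 0 ≤ r := Real.rpow_nonneg ht _
  have hf := L1.integrable_coeFn f
  have hK := polyKernel_integrable n m hm
  have hcw := continuous_polyWeight (n := n) hR
  have hint : ∀ h : EuclideanSpace ℝ (Fin n), Integrable fun x => polyWeight n R (x + h) * f x :=
    fun h => hf.bdd_mul (c := 1) (hcw.comp (by fun_prop : Continuous fun x => x + h)).aestronglyMeasurable
      (ae_of_all _ fun x => abs_polyWeight_le_one hR _)
  have hint0 : Integrable fun x => polyWeight n R x * f x := by simpa using hint 0
  have hintabs : Integrable fun x => polyWeight n R x * |f x| := by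
    refine hint0.norm.congr (ae_of_all _ fun x => ?_)
    simp only
    rw [norm_mul, Real.norm_of_nonneg (polyWeight_pos hR x).le, Real.norm_eq_abs]
  set J := ∫ x, polyWeight n R x * |f x| with hJ
  have hdiff : ∀ z : EuclideanSpace ℝ (Fin n),
      |(∫ x, polyWeight n R (x + r • z) * f x) - ∫ x, polyWeight n R x * f x| ≤
        1 / L * (1 + ‖z‖) ^ (n + 1) * J := by
    intro z
    rw [← integral_sub (hint _) hint0, hJ, ← integral_const_mul, ← Real.norm_eq_abs]
    refine norm_integral_le_of_norm_le (hintabs.const_mul _) (ae_of_all _ fun x => ?_)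
    rw [← sub_mul, norm_mul, Real.norm_eq_abs, Real.norm_eq_abs, ← mul_assoc]
    refine mul_le_mul_of_nonneg_right (abs_polyWeight_add_sub_le hL hR ?_) (abs_nonneg _)
    rw [norm_smul, Real.norm_of_nonneg hr]
    gcongr
    rwa [le_div_iff₀ hL0, mul_comm]
  have hweight : weightedIntegral (polyWeight n R) (memLp_top_polyWeight hR) (polyOp hm t f) =
      ∫ z, polyKernel n m 1 z * ∫ x, polyWeight n R (x + r • z) * f x :=
    weightedIntegral_dilatedConv hK _ r f
  have hKJ : Integrable fun z => polyKernel n m 1 z *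
      ((∫ x, polyWeight n R (x + r • z) * f x) - ∫ x, polyWeight n R x * f x) := by
    refine ((integrable_one_add_norm_pow_mul_polyKernel n hm).mul_const (1 / L * J)).mono' ?_
      (ae_of_all _ fun z => ?_)
    · refine hK.1.mul (AEStronglyMeasurable.sub ?_ aestronglyMeasurable_const)
      refine Continuous.aestronglyMeasurable ?_
      refine continuous_of_dominated (bound := fun x => ‖f x‖) (fun z => (hint _).1)
        (fun z => ae_of_all _ fun x => ?_) hf.norm (ae_of_all _ fun x => ?_)
      · rw [norm_mul]
        exact mul_le_of_le_one_left (norm_nonneg _) (abs_polyWeight_le_one hR _)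
      · exact (hcw.comp (by fun_prop : Continuous fun z : EuclideanSpace ℝ (Fin n) =>
          x + r • z)).mul continuous_const
    · rw [norm_mul, Real.norm_eq_abs, Real.norm_eq_abs]
      calc |polyKernel n m 1 z| * _ ≤ |polyKernel n m 1 z| * (1 / L * (1 + ‖z‖) ^ (n + 1) * J) :=
            mul_le_mul_of_nonneg_left (hdiff z) (abs_nonneg _)
        _ = _ := by ring
  -- As ∫ K = 1, the unshifted weighted integral comes out exactly; the rest is controlled by a
  -- moment of |K|, so the sign of K plays no role.
  have hsplit : (∫ z, polyKernel n m 1 z * ∫ x, polyWeight n R (x + r • z) * f x) =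
      (∫ z, polyKernel n m 1 z *
        ((∫ x, polyWeight n R (x + r • z) * f x) - ∫ x, polyWeight n R x * f x)) +
      ∫ x, polyWeight n R x * f x := by
    have h1 := integral_add hKJ (hK.mul_const (∫ x, polyWeight n R x * f x))
    rw [integral_mul_const, polyKernel_integral n m hm, one_mul] at h1
    rw [← h1]
    congr 1
    ext z
    rw [← mul_add, sub_add_cancel]
  have hbound : |∫ z, polyKernel n m 1 z *
      ((∫ x, polyWeight n R (x + r • z) * f x) - ∫ x, polyWeight n R x * f x)| ≤
      (∫ z : EuclideanSpace ℝ (Fin n), (1 + ‖z‖) ^ (n + 1) * |polyKernel n m 1 z|) / L * J := by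
    rw [div_mul_eq_mul_div, mul_div_assoc, ← integral_mul_const, ← Real.norm_eq_abs]
    refine norm_integral_le_of_norm_le ((integrable_one_add_norm_pow_mul_polyKernel n hm).mul_const _)
      (ae_of_all _ fun z => ?_)
    rw [norm_mul, Real.norm_eq_abs, Real.norm_eq_abs]
    calc |polyKernel n m 1 z| * _ ≤ |polyKernel n m 1 z| * (1 / L * (1 + ‖z‖) ^ (n + 1) * J) :=
          mul_le_mul_of_nonneg_left (hdiff z) (abs_nonneg _)
      _ = _ := by ring
  rw [hweight, hsplit]
  linarith [(abs_le.1 hbound).1]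

/-- Jensen's inequality for the weight. -/
theorem rpow_weighted_integral_le {p : ℝ} (hp : 1 < p) (hR : 0 < R) {f : IntegrableSpace n}
    {g : IntegrableSpace n} (hg : g =ᵐ[volume] fun x => |f x| ^ p) :
    (∫ x, polyWeight n R x) ^ (1 - p) * (∫ x, polyWeight n R x * |f x|) ^ p ≤
      ∫ x, polyWeight n R x * g x := by
  set W := ∫ x, polyWeight n R x with hW
  have hW0 : 0 < W := integral_polyWeight_pos hR
  have hcw := continuous_polyWeight (n := n) hR
  have hint : ∀ h : EuclideanSpace ℝ (Fin n) → ℝ, Integrable h →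
      Integrable fun x => polyWeight n R x * h x :=
    fun h hh => hh.bdd_mul (c := 1) hcw.aestronglyMeasurable
      (ae_of_all _ fun x => abs_polyWeight_le_one hR _)
  have hf := hint _ (L1.integrable_coeFn f).norm
  simp only [Real.norm_eq_abs] at hf
  have hgi := hint _ (L1.integrable_coeFn g)
  set J := ∫ x, polyWeight n R x * |f x| with hJ
  have hJ0 : 0 ≤ J := integral_nonneg fun x => mul_nonneg (polyWeight_pos hR x).le (abs_nonneg _)
  rcases hJ0.eq_or_lt with h0 | hJ0
  · rw [← h0, Real.zero_rpow (by linarith), mul_zero]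
    refine integral_nonneg_of_ae ?_
    filter_upwards [hg] with x hx
    rw [hx]
    exact mul_nonneg (polyWeight_pos hR x).le (Real.rpow_nonneg (abs_nonneg _) _)
  set l := J / W with hl
  have hl0 : 0 < l := div_pos hJ0 hW0
  -- The tangent line of y^p at the weighted mean l, from Bernoulli's inequality; integrating it
  -- against the weight gives Jensen.
  have htan : ∀ y : ℝ, 0 ≤ y → l ^ p * (1 + p * (y / l - 1)) ≤ y ^ p := by
    intro y hy
    have h1 := one_add_mul_self_le_rpow_one_add (s := y / l - 1)
      (by have : 0 ≤ y / l := by positivity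
          linarith) hp.le
    rw [add_sub_cancel, Real.div_rpow hy hl0.le] at h1
    have h2 := mul_le_mul_of_nonneg_left h1 (Real.rpow_nonneg hl0.le p)
    rwa [mul_div_cancel₀ _ (Real.rpow_pos_of_pos hl0 p).ne'] at h2
  have hint2 : Integrable fun x => l ^ p * (1 - p) * polyWeight n R x +
      l ^ p * p / l * (polyWeight n R x * |f x|) :=
    ((integrable_polyWeight hR).const_mul _).add (hf.const_mul _)
  have hle : ∫ x, (l ^ p * (1 - p) * polyWeight n R x +
      l ^ p * p / l * (polyWeight n R x * |f x|)) ≤ ∫ x, polyWeight n R x * g x := by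
    refine integral_mono_ae hint2 hgi ?_
    filter_upwards [hg] with x hx
    rw [hx]
    have := mul_le_mul_of_nonneg_left (htan |f x| (abs_nonneg _)) (polyWeight_pos hR x).le
    refine le_trans (le_of_eq ?_) this
    field_simp
    ring
  rw [integral_add ((integrable_polyWeight hR).const_mul _) (hf.const_mul _), integral_const_mul,
    integral_const_mul, ← hW, ← hJ] at hle
  refine le_trans (le_of_eq ?_) hle
  have h3 : l ^ p * (1 - p) * W + l ^ p * p / l * J = l ^ p * W := by
    have : J = l * W := by rw [hl]; field_simp
    rw [this]
    field_simp
    ring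
  rw [h3, hl, Real.div_rpow hJ0.le hW0.le, Real.rpow_sub hW0, Real.rpow_one]
  ring

end Weight

/-- A nonnegative function that dominates a superlinear integral functional of itself can only
exist on a bounded interval. -/
theorem integral_le_of_superlinear {A w : ℝ → ℝ} (hA : Continuous A) (hw : Continuous w)
    {a p t₀ t₁ : ℝ} (ha : 0 < a) (hp : 1 < p) (ht : t₀ ≤ t₁) (hw0 : ∀ s ∈ Icc t₀ t₁, 0 ≤ w s)
    (hA0 : ∀ s ∈ Icc t₀ t₁, 0 ≤ A s)
    (h : ∀ t ∈ Icc t₀ t₁, a + ∫ s in t₀..t, w s * A s ^ p ≤ A t) :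
    (p - 1) * ∫ s in t₀..t₁, w s ≤ a ^ (1 - p) := by
  have hh : Continuous fun s => w s * A s ^ p :=
    hw.mul (hA.rpow_const fun _ => Or.inr (by linarith))
  have hderiv : ∀ {f : ℝ → ℝ}, Continuous f → ∀ t,
      HasDerivAt (fun t => ∫ s in t₀..t, f s) (f t) t := fun hf t =>
    intervalIntegral.integral_hasDerivAt_right (hf.intervalIntegrable _ _)
      (hf.stronglyMeasurableAtFilter _ _) hf.continuousAt
  set Z : ℝ → ℝ := fun t => a + ∫ s in t₀..t, w s * A s ^ p with hZ
  have hZpos : ∀ t ∈ Icc t₀ t₁, 0 < Z t := fun t ht' => by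
    have : 0 ≤ ∫ s in t₀..t, w s * A s ^ p :=
      intervalIntegral.integral_nonneg ht'.1 fun s hs =>
        mul_nonneg (hw0 s ⟨hs.1, hs.2.trans ht'.2⟩)
          (Real.rpow_nonneg (hA0 s ⟨hs.1, hs.2.trans ht'.2⟩) _)
    exact add_pos_of_pos_of_nonneg ha this
  have hZd : ∀ t, HasDerivAt Z (w t * A t ^ p) t := fun t => (hderiv hh t).const_add a
  have hg : ∀ t ∈ Icc t₀ t₁, HasDerivAt (fun t => Z t ^ (1 - p) + (p - 1) * ∫ s in t₀..t, w s)
      (w t * A t ^ p * (1 - p) * Z t ^ (1 - p - 1) + (p - 1) * w t) t := fun t ht' =>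
    ((hZd t).rpow_const (Or.inl (hZpos t ht').ne')).add ((hderiv hw t).const_mul _)
  -- Since A ≥ Z, Z' = w A^p ≥ w Z^p, so Z^{1-p} decreases at least as fast as (p-1)∫ w grows. As
  -- Z^{1-p} stays nonnegative, this bounds the integral of w.
  have hanti : AntitoneOn (fun t => Z t ^ (1 - p) + (p - 1) * ∫ s in t₀..t, w s) (Icc t₀ t₁) := by
    refine antitoneOn_of_deriv_nonpos (convex_Icc _ _)
      (fun t ht' => (hg t ht').continuousAt.continuousWithinAt)
      (fun t ht' => (hg t (interior_subset ht')).differentiableAt.differentiableWithinAt)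
      fun t ht' => ?_
    have ht'' := interior_subset ht'
    rw [(hg t ht'').deriv]
    have hZ0 := hZpos t ht''
    have h1 : 1 ≤ A t ^ p * Z t ^ (1 - p - 1) := by
      rw [show (1 : ℝ) - p - 1 = -p by ring, Real.rpow_neg hZ0.le, ← div_eq_mul_inv,
        one_le_div (Real.rpow_pos_of_pos hZ0 p)]
      exact Real.rpow_le_rpow hZ0.le (h t ht'') (by linarith)
    have h2 : 0 ≤ w t * (p - 1) := mul_nonneg (hw0 t ht'') (by linarith)
    nlinarith
  have hend := hanti ⟨le_rfl, ht⟩ ⟨ht, le_rfl⟩ ht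
  simp only [hZ, intervalIntegral.integral_same, mul_zero, add_zero] at hend
  have := Real.rpow_nonneg (hZpos t₁ ⟨ht, le_rfl⟩).le (1 - p)
  simp only [hZ] at this
  linarith

/-! ### The superlinear inequality for mild solutions. -/

section BlowUp

variable {n : ℕ}

/-- The absolute value on `L¹`. -/
noncomputable def absL1 (f : IntegrableSpace n) : IntegrableSpace n :=
  lipschitzWith_one_norm.compLp norm_zero f

theorem absL1_coeFn (f : IntegrableSpace n) : absL1 f =ᵐ[volume] fun x => |f x| :=
  LipschitzWith.coeFn_compLp _ _ f

theorem continuous_absL1 : Continuous (absL1 (n := n)) :=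
  LipschitzWith.continuous_compLp lipschitzWith_one_norm norm_zero

theorem continuousAt_polyWeight_integral {R : ℝ → ℝ} {f : ℝ → IntegrableSpace n} {s₀ : ℝ}
    (hR : ContinuousAt R s₀) (hR0 : 0 < R s₀) (hf : Continuous f) :
    ContinuousAt (fun s => ∫ x, polyWeight n (R s) x * |f s x|) s₀ := by
  have heq : (fun s => ∫ x, polyWeight n (R s) x * |f s x|) =
      fun s => ∫ x, polyWeight n (R s) x * absL1 (f s) x := by
    funext s
    refine integral_congr_ae ?_
    filter_upwards [absL1_coeFn (f s)] with x hx
    rw [hx]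
  rw [heq]
  refine tendsto_integral_mul_of_bounded (B := 1) (fun s => ?_) ?_ (fun x => ?_)
    (continuous_absL1.comp hf).continuousAt
  · refine Measurable.aestronglyMeasurable ?_
    unfold polyWeight
    fun_prop
  · filter_upwards [continuousAt_const.eventually_lt hR hR0] with s hs x
    exact abs_polyWeight_le_one hs x
  · have h1 : ContinuousAt (fun s => (1 + ‖x‖ / R s) ^ (n + 1)) s₀ :=
      (continuousAt_const.add (continuousAt_const.div hR hR0.ne')).pow _
    exact h1.inv₀ (by positivity)

theorem tendsto_polyWeight_integral (U : IntegrableSpace n) :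
    Filter.Tendsto (fun R => ∫ x, polyWeight n R x * U x) Filter.atTop (nhds (∫ x, U x)) := by
  have h := tendsto_integral_mul_of_bounded (l := Filter.atTop) (φ := fun R => polyWeight n R)
    (φ₀ := fun _ => 1) (f := fun _ => U) (f₀ := U) (B := 1) (fun R => ?_) ?_ (fun x => ?_)
    tendsto_const_nhds
  · simpa using h
  · refine Measurable.aestronglyMeasurable ?_
    unfold polyWeight
    fun_prop
  · filter_upwards [Filter.eventually_gt_atTop 0] with R hR x
    exact abs_polyWeight_le_one hR x
  · have h1 : Filter.Tendsto (fun R : ℝ => ((1 + ‖x‖ / R) ^ (n + 1))⁻¹) Filter.atTop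
        (nhds (((1 + 0) ^ (n + 1))⁻¹)) :=
      ((tendsto_const_nhds.add (tendsto_const_nhds.div_atTop Filter.tendsto_id)).pow _).inv₀
        (by norm_num)
    simpa [polyWeight] using h1

/-- The weighted integrals of the modulus of a mild solution satisfy a superlinear integral
inequality. -/
theorem exists_superlinear_inequality {m : ℕ} (hm : 1 ≤ m) {p : ℝ} (hp : 1 < p)
    {u₀ : EuclideanSpace ℝ (Fin n) → ℝ} (hu₀ : Integrable u₀) (hpos : 0 < ∫ x, u₀ x) :
    ∃ t₀ L c : ℝ, 0 < t₀ ∧ 0 < L ∧ 0 < c ∧ ∀ {ε T t₁ : ℝ} {u : ℝ → IntegrableSpace n}, 0 < ε →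
      IsMildSolution n m p u₀ ε T u → ∀ (h₁ : t₁ ∈ Ico 0 T), ∀ t ∈ Icc t₀ t₁,
        ε * ((∫ x, u₀ x) / 4) + ∫ s in t₀..t, c * s ^ (-((n : ℝ) / (2 * m) * (p - 1))) *
          (∫ x, polyWeight n (L * s ^ (1 / (2 * m : ℝ))) x *
            |IccExtend h₁.1 (domRestrict (Icc 0 t₁) u) s x|) ^ p ≤
        ∫ x, polyWeight n (L * t ^ (1 / (2 * m : ℝ))) x *
          |IccExtend h₁.1 (domRestrict (Icc 0 t₁) u) t x| := by
  set U := hu₀.toL1 u₀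
  have hU : U =ᵐ[volume] u₀ := Integrable.coeFn_toL1 hu₀
  set I := ∫ x, u₀ x
  have hI : ∫ x, U x = I := integral_congr_ae hU
  set H := ∫ z : EuclideanSpace ℝ (Fin n), (1 + ‖z‖) ^ (n + 1) * |polyKernel n m 1 z|
  have hH : 0 ≤ H := integral_nonneg fun z => by positivity
  -- The first smallness keeps at least half of any nonnegative forcing; the second limits the loss
  -- on the data to I/4.
  obtain ⟨L, hL1, hL2, hL3⟩ : ∃ L : ℝ, 1 ≤ L ∧ H / L ≤ 1 / 2 ∧ H / L * ‖U‖ ≤ I / 4 := by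
    have h4 : 0 ≤ 4 * H * ‖U‖ / I := by positivity
    refine ⟨1 + 2 * H + 4 * H * ‖U‖ / I, by linarith, ?_, ?_⟩
    · rw [div_le_iff₀ (by linarith)]
      linarith
    · rw [div_mul_eq_mul_div, div_le_iff₀ (by linarith)]
      have : I / 4 * (4 * H * ‖U‖ / I) = H * ‖U‖ := by field_simp
      nlinarith
  have hL0 : 0 < L := by linarith
  have hm' : (0 : ℝ) < 2 * m := by positivity
  have hinv : (0 : ℝ) < 1 / (2 * m : ℝ) := by positivity
  have hρ : Filter.Tendsto (fun t : ℝ => L * t ^ (1 / (2 * m : ℝ))) Filter.atTop Filter.atTop :=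
    (tendsto_rpow_atTop hinv).const_mul_atTop hL0
  -- From t₀ on, the weight sees more than half of the mass of the data, which leaves I/2 - I/4 =
  -- I/4 under the linear flow.
  have hev := ((tendsto_polyWeight_integral U).comp hρ).eventually_const_lt
    (show I / 2 < ∫ x, U x by rw [hI]; linarith)
  obtain ⟨t₀', ht₀'⟩ := Filter.eventually_atTop.1 hev
  set t₀ := max t₀' 1
  have ht₀ : 0 < t₀ := lt_max_of_lt_right one_pos
  set W := ∫ x, polyWeight n 1 x
  have hW : 0 < W := integral_polyWeight_pos one_pos
  have hLW : 0 < L ^ n * W := by positivity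
  refine ⟨t₀, L, 1 / 2 * (L ^ n * W) ^ (1 - p), ht₀, hL0,
    mul_pos (by norm_num) (Real.rpow_pos_of_pos hLW _), fun {ε T t₁ u} hε hu h₁ t ht => ?_⟩
  have hRpos : ∀ s : ℝ, 0 < s → 0 < L * s ^ (1 / (2 * m : ℝ)) := fun s hs =>
    mul_pos hL0 (Real.rpow_pos_of_pos hs _)
  obtain ⟨M, hM, hb⟩ := hu.1.exists_bound
  set v := IccExtend h₁.1 (domRestrict (Icc 0 t₁) u)
  have hv : Continuous v := continuous_IccExtend_of_continuousOn hu.1.1 h₁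
  have huv : EqOn v u (Icc 0 t₁) := IccExtend_domRestrict_eqOn h₁.1 u
  have htpos : 0 < t := ht₀.trans_le ht.1
  set F : ℝ → IntegrableSpace n := fun s => truncPowL1 hp hM (v s)
  have hF : Continuous F := (continuous_truncPowL1 hp hM).comp hv
  have hF0 : ∀ s, ∀ᵐ x ∂volume, 0 ≤ F s x := fun s => truncPowL1_ae_nonneg hp hM (v s)
  have hvt : v t = ε • polyOp hm t U + duhamel hm F t := by
    rw [huv ⟨htpos.le, ht.2⟩, hu.eq_duhamel hm hp hM hb hU ⟨htpos.le, ht.2.trans_lt h₁.2⟩]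
    congr 1
    refine duhamel_congr hm htpos.le fun s hs => ?_
    simp only [F]
    rw [huv ⟨hs.1, hs.2.trans ht.2⟩]
  set R := L * t ^ (1 / (2 * m : ℝ))
  have hR : 0 < R := hRpos t htpos
  set ℓ := weightedIntegral (polyWeight n R) (memLp_top_polyWeight hR) with hℓ
  have hint : ∀ {R : ℝ}, 0 < R → ∀ f : IntegrableSpace n,
      Integrable fun x => polyWeight n R x * f x := fun hR f =>
    (L1.integrable_coeFn f).bdd_mul (c := 1) (continuous_polyWeight hR).aestronglyMeasurable
      (ae_of_all _ fun x => abs_polyWeight_le_one hR _)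
  have hintabs : ∀ {R : ℝ}, 0 < R → ∀ f : IntegrableSpace n,
      Integrable fun x => polyWeight n R x * |f x| := fun hR f => by
    refine (hint hR f).norm.congr (ae_of_all _ fun x => ?_)
    simp only
    rw [norm_mul, Real.norm_of_nonneg (polyWeight_pos hR x).le, Real.norm_eq_abs]
  have hlin : I / 4 ≤ ℓ (polyOp hm t U) := by
    have h1 := weightedIntegral_polyOp_ge hm hL1 htpos.le hR le_rfl U
    have h2 := ht₀' t ((le_max_left _ _).trans ht.1)
    simp only [Function.comp_apply] at h2
    have h3 : ∫ x, polyWeight n R x * |U x| ≤ ‖U‖ := by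
      rw [L1.norm_eq_integral_norm]
      refine integral_mono (hintabs hR U) (L1.integrable_coeFn U).norm fun x => ?_
      exact mul_le_of_le_one_left (abs_nonneg _) (polyWeight_le_one hR x)
    have h4 : H / L * ∫ x, polyWeight n R x * |U x| ≤ H / L * ‖U‖ := by gcongr
    linarith
  -- The scale R belongs to time t and is thus admissible for every shorter time t-s. As F s ≥ 0,
  -- the error is at most half of the main term.
  have hstep : ∀ s ∈ Icc 0 t, 1 / 2 * ∫ x, polyWeight n R x * F s x ≤
      ℓ (polyOp hm (t - s) (F s)) := by
    intro s hs
    have h1 := weightedIntegral_polyOp_ge hm hL1 (sub_nonneg.2 hs.2) hR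
      (mul_le_mul_of_nonneg_left (Real.rpow_le_rpow (sub_nonneg.2 hs.2)
        (sub_le_self t hs.1) hinv.le) hL0.le) (F s)
    have h2 : ∫ x, polyWeight n R x * |F s x| = ∫ x, polyWeight n R x * F s x := by
      refine integral_congr_ae ?_
      filter_upwards [hF0 s] with x hx
      rw [abs_of_nonneg hx]
    rw [h2] at h1
    have h3 : 0 ≤ ∫ x, polyWeight n R x * F s x := by
      refine integral_nonneg_of_ae ?_
      filter_upwards [hF0 s] with x hx
      exact mul_nonneg (polyWeight_pos hR x).le hx
    have h4 := mul_le_mul_of_nonneg_right hL2 h3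
    linarith
  have hnonneg : ∀ s ∈ Icc 0 t, 0 ≤ ℓ (polyOp hm (t - s) (F s)) := fun s hs => by
    refine le_trans (mul_nonneg (by norm_num) (integral_nonneg_of_ae ?_)) (hstep s hs)
    filter_upwards [hF0 s] with x hx
    exact mul_nonneg (polyWeight_pos hR x).le hx
  have hlow : ∀ s ∈ Icc t₀ t, 1 / 2 * (L ^ n * W) ^ (1 - p) *
      s ^ (-((n : ℝ) / (2 * m) * (p - 1))) *
        (∫ x, polyWeight n (L * s ^ (1 / (2 * m : ℝ))) x * |v s x|) ^ p ≤
      ℓ (polyOp hm (t - s) (F s)) := by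
    intro s hs
    have hs0 : 0 < s := ht₀.trans_le hs.1
    have hRs := hRpos s hs0
    have hRle : L * s ^ (1 / (2 * m : ℝ)) ≤ R :=
      mul_le_mul_of_nonneg_left (Real.rpow_le_rpow hs0.le hs.2 hinv.le) hL0.le
    refine le_trans ?_ (hstep s ⟨hs0.le, hs.2⟩)
    have hbs : ∀ᵐ x ∂(volume : Measure (EuclideanSpace ℝ (Fin n))), |v s x| ≤ M := by
      rw [huv ⟨hs0.le, hs.2.trans ht.2⟩]
      exact hb s ⟨hs0.le, (hs.2.trans ht.2).trans_lt h₁.2⟩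
    have h1 := rpow_weighted_integral_le hp hRs (truncPowL1_coeFn_of_le hp hM hbs)
    -- The weight increases with its scale, so R(t) may be lowered to R(s), which turns the
    -- integrand into a function of s alone.
    have h2 : ∫ x, polyWeight n (L * s ^ (1 / (2 * m : ℝ))) x * F s x ≤
        ∫ x, polyWeight n R x * F s x := by
      refine integral_mono_ae (hint hRs _) (hint hR _) ?_
      filter_upwards [hF0 s] with x hx
      exact mul_le_mul_of_nonneg_right (polyWeight_mono hRs hRle x) hx
    -- The total mass of the weight scales like R(s)^n, i.e. s^{n/(2m)}; Jensen's power 1-p yields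
    -- the exponent -θ.
    have h3 : (∫ x, polyWeight n (L * s ^ (1 / (2 * m : ℝ))) x) ^ (1 - p) =
        (L ^ n * W) ^ (1 - p) * s ^ (-((n : ℝ) / (2 * m) * (p - 1))) := by
      rw [integral_polyWeight hRs, mul_pow, ← Real.rpow_natCast (s ^ _), ← Real.rpow_mul hs0.le,
        mul_right_comm, Real.mul_rpow hLW.le (Real.rpow_nonneg hs0.le _), ← Real.rpow_mul hs0.le]
      congr 2
      ring
    rw [h3] at h1
    linarith [h1.trans h2]
  have hcℓ : Continuous fun s => ℓ (polyOp hm (t - s) (F s)) :=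
    ℓ.continuous.comp (continuous_polyOp_comp_right hm hF t)
  have hmain : ℓ (v t) = ε * ℓ (polyOp hm t U) + ∫ s in (0 : ℝ)..t, ℓ (polyOp hm (t - s) (F s)) := by
    rw [hvt, map_add, map_smul, smul_eq_mul, duhamel, ContinuousLinearMap.intervalIntegral_comp_comm]
    exact (continuous_polyOp_comp_right hm hF t).intervalIntegrable _ _
  have hsplit : ∫ s in t₀..t, ℓ (polyOp hm (t - s) (F s)) ≤
      ∫ s in (0 : ℝ)..t, ℓ (polyOp hm (t - s) (F s)) := by
    rw [← intervalIntegral.integral_add_adjacent_intervals (hcℓ.intervalIntegrable 0 t₀)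
      (hcℓ.intervalIntegrable t₀ t)]
    have := intervalIntegral.integral_nonneg ht₀.le (μ := volume) fun s hs =>
      hnonneg s ⟨hs.1, hs.2.trans ht.1⟩
    linarith
  have hlowint : ∫ s in t₀..t, 1 / 2 * (L ^ n * W) ^ (1 - p) *
      s ^ (-((n : ℝ) / (2 * m) * (p - 1))) *
        (∫ x, polyWeight n (L * s ^ (1 / (2 * m : ℝ))) x * |v s x|) ^ p ≤
      ∫ s in t₀..t, ℓ (polyOp hm (t - s) (F s)) := by
    refine intervalIntegral.integral_mono_on ht.1 ?_ (hcℓ.intervalIntegrable _ _) hlow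
    refine ContinuousOn.intervalIntegrable fun s hs => ContinuousAt.continuousWithinAt ?_
    rw [uIcc_of_le ht.1] at hs
    have hs0 : 0 < s := ht₀.trans_le hs.1
    refine (continuousAt_const.mul (continuousAt_id.rpow_const (Or.inl hs0.ne'))).mul ?_
    refine ContinuousAt.rpow_const ?_ (Or.inr (by linarith))
    exact continuousAt_polyWeight_integral
      (continuousAt_const.mul (continuousAt_id.rpow_const (Or.inl hs0.ne'))) (hRpos s hs0) hv
  have hle : ℓ (v t) ≤ ∫ x, polyWeight n R x * |v t x| := by
    rw [hℓ, weightedIntegral_apply]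
    exact integral_mono (hint hR _) (hintabs hR _) fun x =>
      mul_le_mul_of_nonneg_left (le_abs_self _) (polyWeight_pos hR x).le
  have := mul_le_mul_of_nonneg_left hlin hε.le
  linarith

/-- Mild solutions exist only for times at which a time integral is controlled by the size of the
data. -/
theorem exists_integral_bound_of_isMildSolution {m : ℕ} (hm : 1 ≤ m) {p : ℝ} (hp : 1 < p)
    {u₀ : EuclideanSpace ℝ (Fin n) → ℝ} (hu₀ : Integrable u₀) (hpos : 0 < ∫ x, u₀ x) :
    ∃ t₀ κ : ℝ, 0 < t₀ ∧ 0 < κ ∧ ∀ {ε T : ℝ} {u : ℝ → IntegrableSpace n}, 0 < ε →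
      IsMildSolution n m p u₀ ε T u → ∀ t₁ ∈ Ico t₀ T,
        ∫ s in t₀..t₁, s ^ (-((n : ℝ) / (2 * m) * (p - 1))) ≤ κ * ε ^ (-(p - 1)) := by
  obtain ⟨t₀, L, c, ht₀, hL, hc, h⟩ := exists_superlinear_inequality hm hp hu₀ hpos
  set I := ∫ x, u₀ x
  have hIp : 0 < (I / 4) ^ (1 - p) := Real.rpow_pos_of_pos (by linarith) _
  have hp' : 0 < p - 1 := by linarith
  -- From a^{1-p} with a = εI/4, after dividing by (p-1)c.
  refine ⟨t₀, (I / 4) ^ (1 - p) / ((p - 1) * c), ht₀, by positivity,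
    fun {ε T u} hε hu t₁ ht₁ => ?_⟩
  have h₁ : t₁ ∈ Ico 0 T := ⟨ht₀.le.trans ht₁.1, ht₁.2⟩
  have hineq := h hε hu h₁
  set v := IccExtend h₁.1 (domRestrict (Icc 0 t₁) u)
  have hv : Continuous v := continuous_IccExtend_of_continuousOn hu.1.1 h₁
  set A : ℝ → ℝ := fun t => ∫ x, polyWeight n (L * t ^ (1 / (2 * m : ℝ))) x * |v t x|
  set w : ℝ → ℝ := fun s => c * s ^ (-((n : ℝ) / (2 * m) * (p - 1)))
  have hRpos : ∀ s : ℝ, 0 < s → 0 < L * s ^ (1 / (2 * m : ℝ)) := fun s hs =>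
    mul_pos hL (Real.rpow_pos_of_pos hs _)
  have hA : ContinuousOn A (Icc t₀ t₁) := fun s hs => by
    have hs0 : 0 < s := ht₀.trans_le hs.1
    exact (continuousAt_polyWeight_integral
      (continuousAt_const.mul (continuousAt_id.rpow_const (Or.inl hs0.ne'))) (hRpos s hs0)
      hv).continuousWithinAt
  have hw : ContinuousOn w (Icc t₀ t₁) := fun s hs =>
    (continuousAt_const.mul (continuousAt_id.rpow_const
      (Or.inl (ht₀.trans_le hs.1).ne'))).continuousWithinAt
  have hw0 : ∀ s ∈ Icc t₀ t₁, 0 ≤ w s := fun s hs =>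
    mul_nonneg hc.le (Real.rpow_nonneg (ht₀.le.trans hs.1) _)
  have hA0 : ∀ s ∈ Icc t₀ t₁, 0 ≤ A s := fun s hs => integral_nonneg fun x =>
    mul_nonneg (polyWeight_pos (hRpos s (ht₀.trans_le hs.1)) x).le (abs_nonneg _)
  have hextA : ∀ s ∈ Icc t₀ t₁, IccExtend ht₁.1 (domRestrict (Icc t₀ t₁) A) s = A s := fun s hs => by
    rw [IccExtend_of_mem _ _ hs, domRestrict_apply]
  have hextw : ∀ s ∈ Icc t₀ t₁, IccExtend ht₁.1 (domRestrict (Icc t₀ t₁) w) s = w s := fun s hs => by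
    rw [IccExtend_of_mem _ _ hs, domRestrict_apply]
  have key := integral_le_of_superlinear
    (continuousOn_iff_continuous_domRestrict.1 hA).Icc_extend'
    (continuousOn_iff_continuous_domRestrict.1 hw).Icc_extend'
    (a := ε * (I / 4)) (by positivity) hp ht₁.1
    (fun s hs => by rw [hextw s hs]; exact hw0 s hs)
    (fun s hs => by rw [hextA s hs]; exact hA0 s hs)
    (fun t ht => by
      rw [hextA t ht]
      refine le_trans (le_of_eq ?_) (hineq t ht)
      congr 1
      refine intervalIntegral.integral_congr fun s hs => ?_
      rw [uIcc_of_le ht.1] at hs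
      have hs' : s ∈ Icc t₀ t₁ := ⟨hs.1, hs.2.trans ht.2⟩
      rw [hextA s hs', hextw s hs'])
  have hwint : ∫ s in t₀..t₁, IccExtend ht₁.1 (domRestrict (Icc t₀ t₁) w) s =
      c * ∫ s in t₀..t₁, s ^ (-((n : ℝ) / (2 * m) * (p - 1))) := by
    rw [← intervalIntegral.integral_const_mul]
    refine intervalIntegral.integral_congr fun s hs => ?_
    rw [uIcc_of_le ht₁.1] at hs
    exact hextw s hs
  rw [hwint, Real.mul_rpow hε.le (by linarith), ← mul_assoc] at key
  rw [div_mul_eq_mul_div ((I / 4) ^ (1 - p)), le_div_iff₀ (by positivity), neg_sub]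
  linarith

end BlowUp

/-! ### From solutions to the lifespan. -/

section Lifespan

variable {n m : ℕ} {p ε : ℝ} {u₀ : EuclideanSpace ℝ (Fin n) → ℝ}

theorem IsMildSolution.mono {T T' : ℝ} (h : T' ≤ T) {u : ℝ → IntegrableSpace n}
    (hu : IsMildSolution n m p u₀ ε T u) : IsMildSolution n m p u₀ ε T' u := by
  obtain ⟨⟨hc, w, hw, hwu⟩, hsol⟩ := hu
  have hr : volume.restrict (Ioo 0 T') ≤ volume.restrict (Ioo 0 T) :=
    Measure.restrict_mono (Ioo_subset_Ioo_right h) le_rfl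
  exact ⟨⟨hc.mono (Ico_subset_Ico_right h), w, hw.mono_measure hr, ae_mono hr hwu⟩,
    fun t ht => hsol t (Ico_subset_Ico_right h ht)⟩

theorem IsMildSolution.congr {T : ℝ} {u v : ℝ → IntegrableSpace n}
    (hu : IsMildSolution n m p u₀ ε T u) (huv : EqOn v u (Ico 0 T)) :
    IsMildSolution n m p u₀ ε T v := by
  obtain ⟨⟨hc, w, hw, hwu⟩, hsol⟩ := hu
  refine ⟨⟨hc.congr huv, w, hw, ?_⟩, fun t ht => ?_⟩
  · filter_upwards [hwu, ae_restrict_mem measurableSet_Ioo] with t h1 ht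
    rw [huv (Ioo_subset_Ico_self ht)]
    exact h1
  · filter_upwards [hsol t ht] with x hx
    rw [huv ht, hx]
    congr 1
    refine intervalIntegral.integral_congr fun s hs => ?_
    rw [uIcc_of_le ht.1] at hs
    rw [huv ⟨hs.1, hs.2.trans_lt ht.2⟩]

theorem le_lifespan (hm : 1 ≤ m) (hp : 1 < p) (hu₀ : Integrable u₀) {T : ℝ} (hT : 0 < T)
    (h : ∃ u, IsMildSolution n m p u₀ ε T u) : ENNReal.ofReal T ≤ lifespan n m p u₀ ε := by
  obtain ⟨u, hu⟩ := h
  exact le_sSup ⟨T, hT, hu.hasUniqueMildSolution hm hp hu₀, rfl⟩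

theorem lifespan_le {B : ℝ} (h : ∀ T u, IsMildSolution n m p u₀ ε T u → T ≤ B) :
    lifespan n m p u₀ ε ≤ ENNReal.ofReal B := by
  refine sSup_le ?_
  rintro τ ⟨T, -, ⟨u, hu, -⟩, rfl⟩
  exact ENNReal.ofReal_le_ofReal (h T u hu)

/-- Mild solutions on different intervals glue to a maximal one. -/
theorem exists_maximal_isMildSolution (hm : 1 ≤ m) (hp : 1 < p) (hu₀ : Integrable u₀) :
    ∃ u : ℝ → IntegrableSpace n,
      (∀ T : ℝ, 0 < T → ENNReal.ofReal T < lifespan n m p u₀ ε → IsMildSolution n m p u₀ ε T u) ∧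
      ∀ (T : ℝ) (v : ℝ → IntegrableSpace n), IsMildSolution n m p u₀ ε T v → EqOn v u (Ico 0 T) := by
  classical
  let P : ℝ → (ℝ → IntegrableSpace n) → Prop := fun t v =>
    ∃ T, t < T ∧ IsMildSolution n m p u₀ ε T v
  -- At each t take the value of some solution living beyond t; by uniqueness the choice does not
  -- matter on t ≥ 0.
  let u : ℝ → IntegrableSpace n := fun t => if h : ∃ v, P t v then h.choose t else 0
  have hu : ∀ (T : ℝ) (v : ℝ → IntegrableSpace n), IsMildSolution n m p u₀ ε T v →
      EqOn v u (Ico 0 T) := by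
    intro T v hv t ht
    have hex : ∃ v, P t v := ⟨v, T, ht.2, hv⟩
    obtain ⟨T', hT', hv'⟩ := hex.choose_spec
    have heq := (hv.mono (min_le_left T T')).eqOn hm hp hu₀ (hv'.mono (min_le_right T T'))
      ⟨ht.1, lt_min ht.2 hT'⟩
    simp only [u, dif_pos hex]
    exact heq
  refine ⟨u, fun T hT hlt => ?_, hu⟩
  obtain ⟨τ, ⟨T', hT', ⟨v, hv, -⟩, rfl⟩, hτ⟩ := lt_sSup_iff.1 hlt
  have hTT' : T < T' := (ENNReal.ofReal_lt_ofReal_iff hT').1 hτ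
  have hvT := hv.mono hTT'.le
  exact hvT.congr fun t ht => (hu T v hvT ht).symm

theorem exists_pos_hasUniqueMildSolution (hm : 1 ≤ m) (hp : 1 < p) (hu₀ : Integrable u₀)
    (hu₀' : MemLp u₀ ∞ volume) (hε : 0 < ε) :
    ∃ T : ℝ, 0 < T ∧ HasUniqueMildSolution n m p u₀ ε T := by
  obtain ⟨κ, hκ, hex⟩ := exists_isMildSolution n hm hp hu₀ hu₀'
  have hεp := Real.rpow_pos_of_pos hε (p - 1)
  -- The integrand (1+s)^{-θ} is at most 1, so this length meets the smallness condition.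
  have hT : 0 < κ / ε ^ (p - 1) := by positivity
  obtain ⟨u, hu⟩ := hex ε _ hε hT (by
    have hle : ∫ s in (0 : ℝ)..κ / ε ^ (p - 1), (1 + s) ^ (-((n : ℝ) / (2 * m) * (p - 1))) ≤
        ∫ s in (0 : ℝ)..κ / ε ^ (p - 1), (1 : ℝ) := by
      refine intervalIntegral.integral_mono_on hT.le (intervalIntegrable_one_add_rpow _ hT.le)
        (by simp) fun s hs => ?_
      refine Real.rpow_le_one_of_one_le_of_nonpos (by linarith [hs.1]) ?_
      have : 0 ≤ (n : ℝ) / (2 * m) * (p - 1) := mul_nonneg (by positivity) (by linarith)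
      linarith
    rw [intervalIntegral.integral_const, sub_zero, smul_eq_mul, mul_one] at hle
    refine (mul_le_mul_of_nonneg_left hle hεp.le).trans (le_of_eq ?_)
    field_simp)
  exact ⟨_, hT, hu.hasUniqueMildSolution hm hp hu₀⟩

theorem le_of_forall_mem_Ico_le {t₀ T B : ℝ} (hB : t₀ ≤ B) (h : ∀ t ∈ Ico t₀ T, t ≤ B) :
    T ≤ B := by
  by_contra! hlt
  have := h ((B + T) / 2) ⟨by linarith, by linarith⟩
  linarith

theorem exists_lifespan_bounds_subcritical (hm : 1 ≤ m) (hp : 1 < p) (hu₀ : Integrable u₀)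
    (hu₀' : MemLp u₀ ∞ volume) (hpos : 0 < ∫ x, u₀ x)
    (hθ : (n : ℝ) / (2 * m) * (p - 1) < 1) :
    ∃ ε₀ c C : ℝ, 0 < ε₀ ∧ 0 < c ∧ 0 < C ∧ ∀ ε : ℝ, 0 < ε → ε < ε₀ →
      ENNReal.ofReal (c * ε ^ (-(1 / (p - 1) - (n : ℝ) / (2 * m))⁻¹)) ≤ lifespan n m p u₀ ε ∧
      lifespan n m p u₀ ε ≤
        ENNReal.ofReal (C * ε ^ (-(1 / (p - 1) - (n : ℝ) / (2 * m))⁻¹)) := by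
  obtain ⟨κ, hκ, hex⟩ := exists_isMildSolution n hm hp hu₀ hu₀'
  obtain ⟨t₀, κ', ht₀, hκ', hbd⟩ := exists_integral_bound_of_isMildSolution hm hp hu₀ hpos
  set θ := (n : ℝ) / (2 * m) * (p - 1) with hθdef
  have hp' : 0 < p - 1 := by linarith
  have hθ0 : 0 ≤ θ := by positivity
  have h1θ : 0 < 1 - θ := by linarith
  -- The exponent is the one obtained by solving T^{1-θ} ~ ε^{-(p-1)} for T.
  have hγ : -(1 / (p - 1) - (n : ℝ) / (2 * m))⁻¹ = -(p - 1) * (1 / (1 - θ)) := by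
    have : 1 / (p - 1) - (n : ℝ) / (2 * m) = (1 - θ) / (p - 1) := by
      rw [hθdef, sub_div, mul_div_assoc, div_self hp'.ne', mul_one]
    rw [this, inv_div]
    ring
  rw [hγ]
  have hroot : ∀ {x : ℝ}, 0 ≤ x → (x ^ (1 / (1 - θ))) ^ (1 - θ) = x := fun hx => by
    rw [← Real.rpow_mul hx, one_div_mul_cancel h1θ.ne', Real.rpow_one]
  -- The term t₀^{1-θ} is absorbed because ε^{-(p-1)} ≥ 1 for ε < 1.
  set D := t₀ ^ (1 - θ) + (1 - θ) * κ'
  have hD : 0 < D := by positivity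
  refine ⟨1, (κ * (1 - θ)) ^ (1 / (1 - θ)), D ^ (1 / (1 - θ)), one_pos, by positivity,
    by positivity, fun ε hε hε1 => ⟨?_, ?_⟩⟩
  · have hεp : 0 < ε ^ (-(p - 1)) := Real.rpow_pos_of_pos hε _
    rw [Real.rpow_mul hε.le, ← Real.mul_rpow (by positivity) hεp.le]
    set T := (κ * (1 - θ) * ε ^ (-(p - 1))) ^ (1 / (1 - θ)) with hTdef
    have hT : 0 < T := by positivity
    refine le_lifespan hm hp hu₀ hT (hex ε T hε hT ?_)
    have hle : ∫ s in (0 : ℝ)..T, (1 + s) ^ (-θ) ≤ ∫ s in (0 : ℝ)..T, s ^ (-θ) := by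
      refine intervalIntegral.integral_mono_on_of_le_Ioo hT.le
        (intervalIntegrable_one_add_rpow _ hT.le)
        (intervalIntegral.intervalIntegrable_rpow' (by linarith)) fun s hs => ?_
      exact Real.rpow_le_rpow_of_nonpos hs.1 (by linarith) (by linarith)
    rw [integral_rpow (Or.inl (by linarith)), neg_add_eq_sub, Real.zero_rpow h1θ.ne', sub_zero, hTdef,
      hroot (by positivity)] at hle
    refine (mul_le_mul_of_nonneg_left hle (Real.rpow_pos_of_pos hε (p - 1)).le).trans
      (le_of_eq ?_)
    rw [Real.rpow_neg hε.le]
    have := (Real.rpow_pos_of_pos hε (p - 1)).ne'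
    field_simp
  · refine lifespan_le fun T u hu => ?_
    have hεp : 1 ≤ ε ^ (-(p - 1)) :=
      Real.one_le_rpow_of_pos_of_le_one_of_nonpos hε hε1.le (by linarith)
    rw [Real.rpow_mul hε.le, ← Real.mul_rpow hD.le (by linarith)]
    have hroot' : ∀ t, 0 < t → t ^ (1 - θ) ≤ D * ε ^ (-(p - 1)) →
        t ≤ (D * ε ^ (-(p - 1))) ^ (1 / (1 - θ)) := by
      intro t ht h
      have := Real.rpow_le_rpow (by positivity) h (by positivity : 0 ≤ 1 / (1 - θ))
      rwa [← Real.rpow_mul ht.le, mul_one_div_cancel h1θ.ne', Real.rpow_one] at this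
    have hpw := Real.rpow_pos_of_pos ht₀ (1 - θ)
    refine le_of_forall_mem_Ico_le (t₀ := t₀) (hroot' t₀ ht₀ ?_) fun t ht => hroot' t
      (ht₀.trans_le ht.1) ?_
    · have : t₀ ^ (1 - θ) ≤ D := le_add_of_nonneg_right (by positivity)
      nlinarith
    · have h1 := hbd hε hu t ht
      rw [integral_rpow (Or.inl (by linarith)), neg_add_eq_sub, div_le_iff₀ h1θ] at h1
      simp only [D]
      nlinarith

theorem exists_lifespan_bounds_critical (hm : 1 ≤ m) (hp : 1 < p) (hu₀ : Integrable u₀)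
    (hu₀' : MemLp u₀ ∞ volume) (hpos : 0 < ∫ x, u₀ x)
    (hθ : (n : ℝ) / (2 * m) * (p - 1) = 1) :
    ∃ ε₀ c C : ℝ, 0 < ε₀ ∧ 0 < c ∧ 0 < C ∧ ∀ ε : ℝ, 0 < ε → ε < ε₀ →
      ENNReal.ofReal (Real.exp (c * ε ^ (-(p - 1)))) ≤ lifespan n m p u₀ ε ∧
      lifespan n m p u₀ ε ≤ ENNReal.ofReal (Real.exp (C * ε ^ (-(p - 1)))) := by
  obtain ⟨κ, hκ, hex⟩ := exists_isMildSolution n hm hp hu₀ hu₀'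
  obtain ⟨t₀, κ', ht₀, hκ', hbd⟩ := exists_integral_bound_of_isMildSolution hm hp hu₀ hpos
  rw [hθ] at hex hbd
  have hp' : 0 < p - 1 := by linarith
  -- The second entry makes (κ/2)ε^{-(p-1)} ≥ 1, so log(1+T) ≤ log 2 + log T ≤ κ ε^{-(p-1)}. The
  -- first gives ε^{-(p-1)} ≥ 1, which absorbs log t₀ in the upper bound.
  refine ⟨min 1 ((κ / 2) ^ (1 / (p - 1))), κ / 2, |Real.log t₀| + κ',
    lt_min one_pos (by positivity), by positivity, by positivity, fun ε hε hε0 => ⟨?_, ?_⟩⟩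
  · have hεκ : ε ^ (p - 1) ≤ κ / 2 := by
      have := Real.rpow_le_rpow hε.le (hε0.le.trans (min_le_right _ _)) hp'.le
      rwa [← Real.rpow_mul (by positivity), one_div_mul_cancel hp'.ne', Real.rpow_one] at this
    have hεp := Real.rpow_pos_of_pos hε (p - 1)
    have hinv : ε ^ (-(p - 1)) = (ε ^ (p - 1))⁻¹ := Real.rpow_neg hε.le _
    have hone : 1 ≤ κ / 2 * ε ^ (-(p - 1)) := by
      rw [hinv, ← div_eq_mul_inv, le_div_iff₀ hεp]
      linarith
    set T := Real.exp (κ / 2 * ε ^ (-(p - 1))) with hTdef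
    have hT : 0 < T := Real.exp_pos _
    refine le_lifespan hm hp hu₀ hT (hex ε T hε hT ?_)
    have hlog : ∫ s in (0 : ℝ)..T, (1 + s) ^ (-(1 : ℝ)) = Real.log (1 + T) := by
      have hd : ∀ s ∈ uIcc 0 T, HasDerivAt (fun s => Real.log (1 + s)) ((1 + s) ^ (-(1 : ℝ))) s := by
        intro s hs
        rw [uIcc_of_le hT.le] at hs
        have h0 : (1 : ℝ) + s ≠ 0 := by linarith [hs.1]
        have := ((hasDerivAt_id s).const_add 1).log h0
        rwa [one_div, ← Real.rpow_neg_one] at this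
      rw [intervalIntegral.integral_eq_sub_of_hasDerivAt hd
        (intervalIntegrable_one_add_rpow _ hT.le)]
      simp
    have hlogle : Real.log (1 + T) ≤ κ * ε ^ (-(p - 1)) := by
      have hT1 : 1 ≤ T := Real.one_le_exp (by linarith)
      have h2 : Real.log (1 + T) ≤ Real.log (2 * T) := Real.log_le_log (by linarith) (by linarith)
      rw [Real.log_mul (by norm_num) hT.ne', hTdef, Real.log_exp] at h2
      have h3 := Real.log_two_lt_d9
      linarith
    rw [hlog]
    calc ε ^ (p - 1) * Real.log (1 + T) ≤ ε ^ (p - 1) * (κ * ε ^ (-(p - 1))) := by gcongr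
      _ = κ := by rw [hinv]; field_simp
  · refine lifespan_le fun T u hu => ?_
    have hεp : 1 ≤ ε ^ (-(p - 1)) :=
      Real.one_le_rpow_of_pos_of_le_one_of_nonpos hε (hε0.le.trans (min_le_left _ _)) (by linarith)
    have hlog : ∀ t, 0 < t → Real.log t ≤ (|Real.log t₀| + κ') * ε ^ (-(p - 1)) →
        t ≤ Real.exp ((|Real.log t₀| + κ') * ε ^ (-(p - 1))) := fun t ht h =>
      (Real.log_le_iff_le_exp ht).1 h
    have hl1 := le_abs_self (Real.log t₀)
    have hl2 : |Real.log t₀| ≤ |Real.log t₀| * ε ^ (-(p - 1)) :=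
      le_mul_of_one_le_right (abs_nonneg _) hεp
    have hl3 : 0 < κ' * ε ^ (-(p - 1)) := by positivity
    refine le_of_forall_mem_Ico_le (t₀ := t₀) (hlog t₀ ht₀ ?_) fun t ht => hlog t
      (ht₀.trans_le ht.1) ?_
    · linarith
    · have ht0 := ht₀.trans_le ht.1
      have h1 := hbd hε hu t ht
      simp_rw [Real.rpow_neg_one] at h1
      rw [integral_inv_of_pos ht₀ ht0, Real.log_div ht0.ne' ht₀.ne'] at h1
      linarith

end Lifespan

theorem theorem1 (n m : ℕ) (hn : 1 ≤ n) (hm : 1 ≤ m) (p : ℝ) (hp : 1 < p)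
    (u₀ : EuclideanSpace ℝ (Fin n) → ℝ) (hu₀ : MemLp u₀ 1 volume) (hu₀' : MemLp u₀ ∞ volume)
    (hpos : 0 < ∫ x, u₀ x) :
    -- existence and uniqueness, locally and up to the lifespan
    (∀ ε : ℝ, 0 < ε →
      (∃ T : ℝ, 0 < T ∧ HasUniqueMildSolution n m p u₀ ε T) ∧
      ∃ u : ℝ → Lp ℝ 1 (volume : Measure (EuclideanSpace ℝ (Fin n))),
        (∀ T : ℝ, 0 < T → ENNReal.ofReal T < lifespan n m p u₀ ε →
          IsMildSolution n m p u₀ ε T u) ∧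
        ∀ (T : ℝ) (v : ℝ → Lp ℝ 1 (volume : Measure (EuclideanSpace ℝ (Fin n)))),
          IsMildSolution n m p u₀ ε T v → EqOn v u (Ico 0 T)) ∧
    -- lifespan in the subcritical case
    (p < 1 + 2 * (m : ℝ) / n →
      ∃ ε₀ c C : ℝ, 0 < ε₀ ∧ 0 < c ∧ 0 < C ∧ ∀ ε : ℝ, 0 < ε → ε < ε₀ →
        ENNReal.ofReal (c * ε ^ (-(1 / (p - 1) - (n : ℝ) / (2 * m))⁻¹)) ≤
            lifespan n m p u₀ ε ∧
        lifespan n m p u₀ ε ≤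
          ENNReal.ofReal (C * ε ^ (-(1 / (p - 1) - (n : ℝ) / (2 * m))⁻¹))) ∧
    -- lifespan in the critical case
    (p = 1 + 2 * (m : ℝ) / n →
      ∃ ε₀ c C : ℝ, 0 < ε₀ ∧ 0 < c ∧ 0 < C ∧ ∀ ε : ℝ, 0 < ε → ε < ε₀ →
        ENNReal.ofReal (Real.exp (c * ε ^ (-(p - 1)))) ≤ lifespan n m p u₀ ε ∧
        lifespan n m p u₀ ε ≤ ENNReal.ofReal (Real.exp (C * ε ^ (-(p - 1))))) := by
  have hi : Integrable u₀ := memLp_one_iff_integrable.1 hu₀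
  have hn0 : (0 : ℝ) < n := by exact_mod_cast hn
  have hm0 : (0 : ℝ) < m := by exact_mod_cast hm
  refine ⟨fun ε hε => ⟨exists_pos_hasUniqueMildSolution hm hp hi hu₀' hε,
    exists_maximal_isMildSolution hm hp hi⟩, fun hlt => ?_, fun heq => ?_⟩
  · refine exists_lifespan_bounds_subcritical hm hp hi hu₀' hpos ?_
    have h1 : p - 1 < 2 * m / n := by linarith
    calc (n : ℝ) / (2 * m) * (p - 1) < n / (2 * m) * (2 * m / n) := by gcongr
      _ = 1 := by field_simp
  · refine exists_lifespan_bounds_critical hm hp hi hu₀' hpos ?_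
    rw [heq, add_sub_cancel_left]
    field_simp
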